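/- Consider the fully homogeneous nearest-neighbour Ising model on the square lattice $\mathbb Z^2$ with all couplings equal to $J$, at the critical inverse temperature: $e^{-2\beta J}=\tan\frac{\theta}{2}$ with $\theta=\frac{\pi}{4}$. For a finite $\Lambda\subset\mathbb Z^2$ let $\mathbb E^+_\Lambda$ denote the expectation for the model in $\Lambda$ with $+$ boundary conditions: $\sigma_x\in\{\pm1\}$ for $x\in\Lambda$, $\sigma_x=+1$ for $x\notin\Lambda$, and $\mathbb P^+_\Lambda[\sigma]\propto\exp\bigl[\beta J\sum_{uw}\sigma_u\sigma_w\bigr]$, where the sum is over all nearest-neighbour edges $uw$ of $\mathbb Z^2$ with at least one endpoint in $\Lambda$. Then, for every integer $n\ge 0$, the infinite-volume diagonal spin-spin correlation at $n$ diagonal steps $$D_n:=\lim_{\Lambda\uparrow\mathbb Z^2}\mathbb E^+_\Lambda\bigl[\sigma_{(0,0)}\,\sigma_{(n,n)}\bigr]$$ (the limit along the finite subsets of $\mathbb Z^2$ directed by inclusion) exists and is given by $$D_n=\Bigl(\frac{2}{\pi}\Bigr)^{n}\prod_{k=1}^{n-1}\Bigl(1-\frac{1}{4k^2}\Bigr)^{k-n},$$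 where the product is $1$ for $n\le 1$. -/

import Mathlib

open Filter Topology

namespace Ising

/-- A site of the square lattice. The homogeneous model is considered on `ℤ²` with its usual
nearest-neighbour structure; up to a similarity this is the square grid rotated by `π / 4`. -/
abbrev Site : Type := ℤ × ℤ

/-- The nearest-neighbour edges of `ℤ²` with at least one endpoint in `Λ`, each of them listed once,
oriented to the right or upwards. -/
def edges (Λ : Finset Site) : Finset (Site × Site) :=
  (Λ.image fun x => (x, x + (1, 0))) ∪ (Λ.image fun x => (x - (1, 0), x)) ∪
    ((Λ.image fun x => (x, x + (0, 1))) ∪ (Λ.image fun x => (x - (0, 1), x)))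

theorem mem_edges (Λ : Finset Site) (u w : Site) :
    (u, w) ∈ edges Λ ↔ (w = u + (1, 0) ∨ w = u + (0, 1)) ∧ (u ∈ Λ ∨ w ∈ Λ) := by
  simp only [edges, Finset.mem_union, Finset.mem_image, Prod.mk.injEq]
  constructor
  · rintro ((⟨x, hx, rfl, rfl⟩ | ⟨x, hx, rfl, rfl⟩) | (⟨x, hx, rfl, rfl⟩ | ⟨x, hx, rfl, rfl⟩)) <;>
      simp [hx]
  · rintro ⟨rfl | rfl, h | h⟩
    · exact Or.inl (Or.inl ⟨u, h, rfl, rfl⟩)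
    · exact Or.inl (Or.inr ⟨_, h, by simp, rfl⟩)
    · exact Or.inr (Or.inl ⟨u, h, rfl, rfl⟩)
    · exact Or.inr (Or.inr ⟨_, h, by simp, rfl⟩)

/-- The extension of a spin configuration on `Λ` to the whole lattice by `+1` outside `Λ`. -/
def plusExtend (Λ : Finset Site) (σ : Λ → ℤˣ) : Site → ℤˣ :=
  fun x => if h : x ∈ Λ then σ ⟨x, h⟩ else 1

noncomputable section

/-- The real value `±1` of a spin. -/
def spin (s : ℤˣ) : ℝ := ((s : ℤ) : ℝ)

/-- The Boltzmann weight `exp (β ∑ J σ_u σ_w)` of a configuration in `Λ` with `+` boundary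
conditions, the sum being over all edges `uw` that touch `Λ`. -/
def weight (β J : ℝ) (Λ : Finset Site) (σ : Λ → ℤˣ) : ℝ :=
  Real.exp (β * ∑ e ∈ edges Λ,
    J * spin (plusExtend Λ σ e.1) * spin (plusExtend Λ σ e.2))

/-- The partition function in `Λ` with `+` boundary conditions. -/
def partitionFunction (β J : ℝ) (Λ : Finset Site) : ℝ :=
  ∑ σ : Λ → ℤˣ, weight β J Λ σ

/-- The probability of a configuration in the Ising model in `Λ` with `+` boundary conditions. -/
def prob (β J : ℝ) (Λ : Finset Site) (σ : Λ → ℤˣ) : ℝ :=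
  weight β J Λ σ / partitionFunction β J Λ

/-- The expectation of an observable in the Ising model in `Λ` with `+` boundary conditions. -/
def expectation (β J : ℝ) (Λ : Finset Site) (f : (Site → ℤˣ) → ℝ) : ℝ :=
  ∑ σ : Λ → ℤˣ, prob β J Λ σ * f (plusExtend Λ σ)

/-- The correlation of two spins at distance of `n` diagonal steps in the Ising model in `Λ` with
`+` boundary conditions. -/
def diagonalCorrelation (β J : ℝ) (Λ : Finset Site) (n : ℕ) : ℝ :=
  expectation β J Λ fun σ => spin (σ (0, 0)) * spin (σ ((n : ℤ), (n : ℤ)))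

/-- `D` is the infinite-volume limit of the diagonal correlation at `n` diagonal steps: the limit
of the correlations in finite domains `Λ ↑ ℤ²` with `+` boundary conditions. The limit is taken
along the directed set of all finite domains, hence along every increasing sequence of finite
domains that exhausts `ℤ²`. -/
def IsInfiniteVolumeDiagonalCorrelation (β J : ℝ) (n : ℕ) (D : ℝ) : Prop :=
  Tendsto (fun Λ : Finset Site => diagonalCorrelation β J Λ n) atTop (𝓝 D)

end

end Ising

/-! Put K = βJ. At criticality sinh 2K = 1 and cosh 2K = √2, so reversing the coupling on one edge
multiplies the weight by √2 ∓ σσ'. Together with gauge invariance (flipping the spins of a finite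
set), this gives linear relations between mixed correlations of spins and disorder lines. Placing
one spin and one disorder endpoint at a moving corner yields a fermionic observable, discrete
harmonic up to branch signs except at the branch site (a,a) and the branch face (m,m), m = a + n
(`IsCriticalState.local_relation`, `IsCriticalState.cornerObs_relation`).

Symmetrizing in the diagonal gives a bounded harmonic function above the diagonal, zero on it
outside the segment [a,m]. Its normal derivative on the segment vanishes except at the two ends,
where it involves the spin and disorder correlations S and D at distance n+1; its boundary values at
the ends are those at distance n. The Dirichlet-to-Neumann map has symbol |sin s|, that is, kernel
(2/π)/(1 - 4m²). The result is a Toeplitz system with data at its two ends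
(`IsCriticalState.toeplitz_system`). Pairing it with explicit test vectors built from central
binomial coefficients relates the end values through the Wallis product W(n): S + D is multiplied by
(2/π)W(n), and S - D by the same factor times (n+1)/n (`IsCriticalState.corr_succ`).

The start S₁ + D₁ = 4/π leaves one unknown δ in S₁ = (2/π)(1+δ), and the recursion gives Sₙ =
`diagCorr n` · (1 + nδ). Since n · `diagCorr n` is unbounded while correlations are at most 1, δ =
0; no duality argument is needed.

The limit of spin correlations exists and is translation invariant by Griffiths monotonicity. Mixed
correlations are only taken along ultrafilters, which suffices because every such limit gives the
same diagonal spin correlations. -/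

open scoped symmDiff

/-! ### Toeplitz systems with kernel 1 / (1 - 4m²) -/

namespace Ising

/-- The normalized central binomial coefficients, the Taylor coefficients of `(1 - x) ^ (-1/2)`. -/
noncomputable def halfBinom (j : ℕ) : ℝ := (j.centralBinom : ℝ) / 4 ^ j

theorem halfBinom_zero : halfBinom 0 = 1 := by simp [halfBinom]

theorem halfBinom_pos (j : ℕ) : 0 < halfBinom j := by
  have := j.centralBinom_pos
  unfold halfBinom
  positivity

theorem halfBinom_succ (j : ℕ) : ((j : ℝ) + 1) * halfBinom (j + 1) = (j + 1 / 2) * halfBinom j := by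
  have h := Nat.succ_mul_centralBinom_succ j
  have h' : ((j : ℝ) + 1) * ((j + 1).centralBinom : ℝ) = 2 * (2 * j + 1) * (j.centralBinom : ℝ) := by
    exact_mod_cast h
  unfold halfBinom
  rw [pow_succ]
  field_simp
  linarith

theorem sum_halfBinom_reflect (n : ℕ) (f : ℕ → ℝ) :
    ∑ j ∈ Finset.range (n + 1), halfBinom j * halfBinom (n - j) * f (n - j) =
      ∑ j ∈ Finset.range (n + 1), halfBinom j * halfBinom (n - j) * f j := by
  rw [← Finset.sum_range_reflect]
  refine Finset.sum_congr rfl fun j hj => ?_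
  have hj' : j ≤ n := by simpa [Nat.lt_succ_iff] using hj
  have h1 : n + 1 - 1 - j = n - j := by omega
  have h2 : n - (n - j) = j := by omega
  rw [h1, h2]
  ring

/-- The square of (1 - x)^(-1/2) is the geometric series. In coefficients: by reflection the sum
weighted by j is half of n+1 times the plain sum, and `halfBinom_succ` lowers it to level n. -/
theorem sum_halfBinom_mul (n : ℕ) :
    ∑ j ∈ Finset.range (n + 1), halfBinom j * halfBinom (n - j) = 1 := by
  induction n with
  | zero => simp [halfBinom_zero]
  | succ n ih =>
    have e1 : ∑ j ∈ Finset.range (n + 1 + 1), halfBinom j * halfBinom (n + 1 - j) * ((n + 1 - j : ℕ) : ℝ)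
        = ∑ j ∈ Finset.range (n + 1 + 1), halfBinom j * halfBinom (n + 1 - j) * (j : ℝ) :=
      sum_halfBinom_reflect (n + 1) fun j => (j : ℝ)
    have e2 : ∑ j ∈ Finset.range (n + 1), halfBinom j * halfBinom (n - j) * ((n - j : ℕ) : ℝ)
        = ∑ j ∈ Finset.range (n + 1), halfBinom j * halfBinom (n - j) * (j : ℝ) :=
      sum_halfBinom_reflect n fun j => (j : ℝ)
    have e3 : ∑ j ∈ Finset.range (n + 1 + 1), halfBinom j * halfBinom (n + 1 - j) * (j : ℝ)
        = ∑ j ∈ Finset.range (n + 1), halfBinom j * halfBinom (n - j) * ((j : ℝ) + 1 / 2) := by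
      rw [Finset.sum_range_succ']
      simp only [Nat.cast_zero, mul_zero, add_zero]
      refine Finset.sum_congr rfl fun j _ => ?_
      have := halfBinom_succ j
      rw [Nat.add_sub_add_right]
      push_cast
      linear_combination halfBinom (n - j) * this
    have e4 : ∑ j ∈ Finset.range (n + 1 + 1), halfBinom j * halfBinom (n + 1 - j) * ((n + 1 - j : ℕ) : ℝ)
        = (n + 1) * ∑ j ∈ Finset.range (n + 1 + 1), halfBinom j * halfBinom (n + 1 - j)
          - ∑ j ∈ Finset.range (n + 1 + 1), halfBinom j * halfBinom (n + 1 - j) * (j : ℝ) := by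
      rw [Finset.mul_sum, ← Finset.sum_sub_distrib]
      refine Finset.sum_congr rfl fun j hj => ?_
      have hj' : j ≤ n + 1 := by simpa [Nat.lt_succ_iff] using hj
      push_cast [Nat.cast_sub hj']
      ring
    have e5 : ∑ j ∈ Finset.range (n + 1), halfBinom j * halfBinom (n - j) * ((n - j : ℕ) : ℝ)
        = n * ∑ j ∈ Finset.range (n + 1), halfBinom j * halfBinom (n - j)
          - ∑ j ∈ Finset.range (n + 1), halfBinom j * halfBinom (n - j) * (j : ℝ) := by
      rw [Finset.mul_sum, ← Finset.sum_sub_distrib]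
      refine Finset.sum_congr rfl fun j hj => ?_
      have hj' : j ≤ n := by simpa [Nat.lt_succ_iff] using hj
      push_cast [Nat.cast_sub hj']
      ring
    have e6 : ∑ j ∈ Finset.range (n + 1), halfBinom j * halfBinom (n - j) * ((j : ℝ) + 1 / 2)
        = ∑ j ∈ Finset.range (n + 1), halfBinom j * halfBinom (n - j) * (j : ℝ)
          + 1 / 2 * ∑ j ∈ Finset.range (n + 1), halfBinom j * halfBinom (n - j) := by
      rw [Finset.mul_sum, ← Finset.sum_add_distrib]
      exact Finset.sum_congr rfl fun j _ => by ring
    rw [ih] at e5 e6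
    have hn : (n : ℝ) + 1 ≠ 0 := by positivity
    apply mul_left_cancel₀ hn
    linarith

/-- The rational function with simple poles at `0, …, n` and residues
`halfBinom j * halfBinom (n - j)`. -/
noncomputable def poleSum (n : ℕ) (x : ℝ) : ℝ :=
  ∑ j ∈ Finset.range (n + 1), halfBinom j * halfBinom (n - j) / (x - j)

/-- Writing (x - c)/(x - j) = 1 - (c - j)/(x - j) on both sides, the constants sum to 1 by
`sum_halfBinom_mul` and the remainders agree by `halfBinom_succ`. Hence `poleSum n` is the product
of x - k + 1/2 over 1 ≤ k ≤ n divided by the product of x - j over 0 ≤ j ≤ n, which shows all its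
zeros. -/
theorem poleSum_succ (n : ℕ) (x : ℝ) (hx : ∀ j : ℕ, x - j ≠ 0) :
    (x - n - 1) * poleSum (n + 1) x = (x - n - 1 / 2) * poleSum n x := by
  have e1 : (x - n - 1) * poleSum (n + 1) x =
      ∑ j ∈ Finset.range (n + 1 + 1), halfBinom j * halfBinom (n + 1 - j)
      - ∑ j ∈ Finset.range (n + 1), halfBinom j * halfBinom (n - j) * (n + 1 / 2 - j) / (x - j) := by
    have : ∑ j ∈ Finset.range (n + 1), halfBinom j * halfBinom (n - j) * (n + 1 / 2 - j) / (x - j)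
        = ∑ j ∈ Finset.range (n + 1 + 1),
          halfBinom j * halfBinom (n + 1 - j) * (n + 1 - j) / (x - j) := by
      rw [Finset.sum_range_succ _ (n + 1)]
      push_cast
      rw [show (n : ℝ) + 1 - (n + 1) = 0 by ring, mul_zero, zero_div, add_zero]
      refine Finset.sum_congr rfl fun j hj => ?_
      have hj' : j ≤ n := by simpa [Nat.lt_succ_iff] using hj
      have := halfBinom_succ (n - j)
      rw [show n - j + 1 = n + 1 - j by omega] at this
      push_cast [Nat.cast_sub hj'] at this
      congr 1
      linear_combination (-halfBinom j) * this
    rw [this, poleSum, Finset.mul_sum, ← Finset.sum_sub_distrib]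
    refine Finset.sum_congr rfl fun j _ => ?_
    have := hx j
    field_simp
    ring
  rw [e1, sum_halfBinom_mul, ← sum_halfBinom_mul n, poleSum, Finset.mul_sum,
    ← Finset.sum_sub_distrib]
  refine Finset.sum_congr rfl fun j _ => ?_
  have := hx j
  field_simp
  ring

theorem half_int_sub_ne_zero (k : ℤ) (j : ℤ) : (k : ℝ) - 1 / 2 - j ≠ 0 := by
  intro h
  have h2 : (2 * k - 1 - 2 * j : ℤ) = 0 := by
    have : ((2 * k - 1 - 2 * j : ℤ) : ℝ) = 0 := by push_cast; linarith
    exact_mod_cast this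
  omega

theorem poleSum_eq_zero {n k : ℕ} (hk : 1 ≤ k) (hkn : k ≤ n) :
    poleSum n ((k : ℝ) - 1 / 2) = 0 := by
  induction n, hkn using Nat.le_induction with
  | base =>
    obtain ⟨k, rfl⟩ := Nat.exists_eq_add_of_le' hk
    have h := poleSum_succ k (((k + 1 : ℕ) : ℝ) - 1 / 2)
      (fun j => by exact_mod_cast half_int_sub_ne_zero (k + 1 : ℕ) j)
    push_cast at h ⊢
    rw [show (k : ℝ) + 1 - 1 / 2 - k - 1 / 2 = 0 by ring, zero_mul] at h
    refine (mul_eq_zero.1 h).resolve_left ?_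
    ring_nf
    norm_num
  | succ n hn ih =>
    have h := poleSum_succ n ((k : ℝ) - 1 / 2)
      (fun j => by exact_mod_cast half_int_sub_ne_zero k j)
    rw [ih, mul_zero] at h
    refine (mul_eq_zero.1 h).resolve_left ?_
    have := half_int_sub_ne_zero k (n + 1)
    push_cast at this
    intro h'
    apply this
    linarith

theorem poleSum_neg_half (n : ℕ) :
    poleSum n (-1 / 2) = -2 / (halfBinom n * (2 * n + 1)) := by
  induction n with
  | zero => norm_num [poleSum, halfBinom_zero]
  | succ n ih =>
    have h := poleSum_succ n (-1 / 2) (fun j => by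
      have := half_int_sub_ne_zero 0 j
      push_cast at this
      intro h'
      apply this
      linarith)
    have hb := halfBinom_succ n
    have h1 := halfBinom_pos n
    have h2 := halfBinom_pos (n + 1)
    rw [ih] at h
    have hb' : halfBinom (n + 1) = (n + 1 / 2) * halfBinom n / (n + 1) := by
      field_simp at hb ⊢
      linarith
    rw [hb']
    have hn : (-1 / 2 - (n : ℝ) - 1) ≠ 0 := by
      have : (0 : ℝ) ≤ n := by positivity
      linarith
    apply mul_left_cancel₀ hn
    rw [h]
    push_cast
    field_simp
    ring

theorem halfBinom_sq_mul (n : ℕ) : halfBinom n ^ 2 * (2 * n + 1) * Real.Wallis.W n = 1 := by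
  induction n with
  | zero => simp [halfBinom_zero, Real.Wallis.W]
  | succ n ih =>
    have hb := halfBinom_succ n
    have hb' : halfBinom (n + 1) = (n + 1 / 2) * halfBinom n / (n + 1) := by
      field_simp at hb ⊢
      linarith
    rw [Real.Wallis.W_succ, hb']
    refine Eq.trans ?_ ih
    push_cast
    field_simp
    ring

/-- The kernel `1 / (1 - 4 m ^ 2)` applied to `halfBinom j * halfBinom (n - j)`. -/
theorem sum_kernel_even (n k : ℕ) :
    ∑ j ∈ Finset.range (n + 1), halfBinom j * halfBinom (n - j) / (1 - 4 * ((k : ℝ) - j) ^ 2) =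
      (poleSum n (k + 1 / 2) - poleSum n (k - 1 / 2)) / 4 := by
  rw [poleSum, poleSum, ← Finset.sum_sub_distrib, Finset.sum_div]
  refine Finset.sum_congr rfl fun j _ => ?_
  have h1 := half_int_sub_ne_zero k j
  have h2 := half_int_sub_ne_zero (k + 1) j
  push_cast at h1 h2
  obtain ⟨u, hu⟩ : ∃ u : ℝ, u = k - 1 / 2 - j := ⟨_, rfl⟩
  rw [← hu] at h1
  have h3 : u + 1 ≠ 0 := fun h => h2 (by linarith)
  rw [show 1 - 4 * ((k : ℝ) - j) ^ 2 = -4 * u * (u + 1) by rw [hu]; ring,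
    show (k : ℝ) + 1 / 2 - j = u + 1 by rw [hu]; ring, ← hu]
  field_simp
  ring

/-- Same partial fractions as in the even case; (2j - n)/(x - j) = (2x - n)/(x - j) - 2, and the
constants -2 cancel between x = k + 1/2 and x = k - 1/2. -/
theorem sum_kernel_odd (n k : ℕ) :
    ∑ j ∈ Finset.range (n + 1),
        halfBinom j * halfBinom (n - j) * (2 * j - n) / (1 - 4 * ((k : ℝ) - j) ^ 2) =
      ((2 * k + 1 - n) * poleSum n (k + 1 / 2) - (2 * k - 1 - n) * poleSum n (k - 1 / 2)) / 4 := by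
  rw [poleSum, poleSum, Finset.mul_sum, Finset.mul_sum, ← Finset.sum_sub_distrib, Finset.sum_div]
  refine Finset.sum_congr rfl fun j _ => ?_
  have h1 := half_int_sub_ne_zero k j
  have h2 := half_int_sub_ne_zero (k + 1) j
  push_cast at h1 h2
  obtain ⟨u, hu⟩ : ∃ u : ℝ, u = k - 1 / 2 - j := ⟨_, rfl⟩
  rw [← hu] at h1
  have h3 : u + 1 ≠ 0 := fun h => h2 (by linarith)
  rw [show 1 - 4 * ((k : ℝ) - j) ^ 2 = -4 * u * (u + 1) by rw [hu]; ring,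
    show (k : ℝ) + 1 / 2 - j = u + 1 by rw [hu]; ring, ← hu, show (k : ℝ) = u + 1 / 2 + j by rw [hu]; ring]
  field_simp
  ring

theorem poleSum_top (n : ℕ) : poleSum n (n + 1 / 2) = 2 / (halfBinom n * (2 * n + 1)) := by
  have h : poleSum n (n + 1 / 2) = -poleSum n (-1 / 2) := by
    have e := sum_halfBinom_reflect n fun j => 1 / ((-1 / 2 : ℝ) - j)
    simp only [mul_one_div] at e
    rw [poleSum, poleSum, ← e, ← Finset.sum_neg_distrib]
    refine Finset.sum_congr rfl fun j hj => ?_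
    have hj' : j ≤ n := by simpa [Nat.lt_succ_iff] using hj
    push_cast [Nat.cast_sub hj']
    rw [← div_neg]
    congr 1
    ring
  rw [h, poleSum_neg_half]
  ring

/-- The kernel is symmetric, so it can be moved onto a test vector p; a good choice of p isolates
the end values of q without solving the system. -/
theorem sum_symm_kernel (n : ℕ) (p q r : ℕ → ℝ)
    (h : ∀ k ≤ n, ∑ j ∈ Finset.range (n + 1), q j / (1 - 4 * ((k : ℝ) - j) ^ 2) = r k) :
    ∑ k ∈ Finset.range (n + 1), p k * r k =
      ∑ k ∈ Finset.range (n + 1), q k *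
        ∑ j ∈ Finset.range (n + 1), p j / (1 - 4 * ((k : ℝ) - j) ^ 2) := by
  have : ∀ k ∈ Finset.range (n + 1), p k * r k =
      ∑ j ∈ Finset.range (n + 1), p k * (q j / (1 - 4 * ((k : ℝ) - j) ^ 2)) := by
    intro k hk
    rw [← h k (by simpa [Nat.lt_succ_iff] using hk), Finset.mul_sum]
  rw [Finset.sum_congr rfl this, Finset.sum_comm]
  refine Finset.sum_congr rfl fun j _ => ?_
  rw [Finset.mul_sum]
  refine Finset.sum_congr rfl fun k _ => ?_
  rw [show ((k : ℝ) - j) ^ 2 = (j - k) ^ 2 by ring]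
  ring

theorem sum_range_eq_ends {n : ℕ} (hn : 1 ≤ n) (f : ℕ → ℝ) (h : ∀ k, 0 < k → k < n → f k = 0) :
    ∑ k ∈ Finset.range (n + 1), f k = f 0 + f n := by
  obtain ⟨n, rfl⟩ := Nat.exists_eq_add_of_le' hn
  rw [Finset.sum_range_succ, Finset.sum_range_succ', Finset.sum_eq_zero, zero_add]
  intro k hk
  exact h _ (Nat.succ_pos _) (by simpa using hk)

/-- The Toeplitz system with kernel `1 / (1 - 4 m ^ 2)` and a right-hand side supported at the two
ends: symmetric part. -/
theorem toeplitz_ends_add {n : ℕ} (hn : 1 ≤ n) (q r : ℕ → ℝ)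
    (h : ∀ k ≤ n, ∑ j ∈ Finset.range (n + 1), q j / (1 - 4 * ((k : ℝ) - j) ^ 2) = r k)
    (h0 : ∀ k, 0 < k → k < n → r k = 0) :
    r n + r 0 = Real.Wallis.W n / 2 * (q n + q 0) := by
  -- The zeros of `poleSum n` at 1/2, …, n - 1/2 make the image of this test vector vanish at
  -- interior points, so both sides of the pairing reduce to the two ends.
  have e := sum_symm_kernel n (fun j => halfBinom j * halfBinom (n - j)) q r h
  have hz1 := poleSum_eq_zero (n := n) (k := n) hn le_rfl
  have hz2 := poleSum_eq_zero (n := n) (k := 1) le_rfl hn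
  rw [sum_range_eq_ends hn _ (fun k h1 h2 => by rw [h0 k h1 h2, mul_zero]),
    sum_range_eq_ends hn _ (fun k h1 h2 => by
      rw [sum_kernel_even n k, poleSum_eq_zero h1 h2.le]
      have := poleSum_eq_zero (n := n) (k := k + 1) (by omega) (by omega)
      push_cast at this
      rw [show (k : ℝ) + 1 / 2 = k + 1 - 1 / 2 by ring, this]
      ring), sum_kernel_even n 0, sum_kernel_even n n, hz1,
    poleSum_top] at e
  push_cast at e hz2
  rw [show (0 : ℝ) + 1 / 2 = 1 - 1 / 2 by ring, hz2, show (0 : ℝ) - 1 / 2 = -1 / 2 by ring,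
    poleSum_neg_half] at e
  simp only [Nat.sub_zero, Nat.sub_self, halfBinom_zero, one_mul, mul_one] at e
  have hb := halfBinom_pos n
  have hw := halfBinom_sq_mul n
  apply mul_left_cancel₀ hb.ne'
  have hw' : Real.Wallis.W n = 1 / (halfBinom n ^ 2 * (2 * n + 1)) := by
    field_simp
    linarith
  rw [hw']
  rw [mul_add, add_comm, e]
  field_simp
  ring

/-- The Toeplitz system with kernel `1 / (1 - 4 m ^ 2)` and a right-hand side supported at the two
ends: antisymmetric part. -/
theorem toeplitz_ends_sub {n : ℕ} (hn : 1 ≤ n) (q r : ℕ → ℝ)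
    (h : ∀ k ≤ n, ∑ j ∈ Finset.range (n + 1), q j / (1 - 4 * ((k : ℝ) - j) ^ 2) = r k)
    (h0 : ∀ k, 0 < k → k < n → r k = 0) :
    r n - r 0 = Real.Wallis.W n / 2 * ((n + 1) / n) * (q n - q 0) := by
  -- The factor 2j - n makes the test vector antisymmetric under j ↦ n - j while keeping its image
  -- supported at the ends.
  have e := sum_symm_kernel n (fun j => halfBinom j * halfBinom (n - j) * (2 * j - n)) q r h
  have hz1 := poleSum_eq_zero (n := n) (k := n) hn le_rfl
  have hz2 := poleSum_eq_zero (n := n) (k := 1) le_rfl hn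
  rw [sum_range_eq_ends hn _ (fun k h1 h2 => by rw [h0 k h1 h2, mul_zero]),
    sum_range_eq_ends hn _ (fun k h1 h2 => by
      rw [sum_kernel_odd n k, poleSum_eq_zero h1 h2.le]
      have := poleSum_eq_zero (n := n) (k := k + 1) (by omega) (by omega)
      push_cast at this
      rw [show (k : ℝ) + 1 / 2 = k + 1 - 1 / 2 by ring, this]
      ring), sum_kernel_odd n 0, sum_kernel_odd n n, hz1,
    poleSum_top] at e
  push_cast at e hz2
  rw [show (0 : ℝ) + 1 / 2 = 1 - 1 / 2 by ring, hz2, show (0 : ℝ) - 1 / 2 = -1 / 2 by ring,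
    poleSum_neg_half] at e
  simp only [Nat.sub_zero, Nat.sub_self, halfBinom_zero, one_mul, mul_one] at e
  have hb := halfBinom_pos n
  have hw := halfBinom_sq_mul n
  have hn' : (n : ℝ) ≠ 0 := by positivity
  have hw' : Real.Wallis.W n = 1 / (halfBinom n ^ 2 * (2 * n + 1)) := by
    field_simp
    linarith
  apply mul_left_cancel₀ (mul_ne_zero hb.ne' hn')
  have e' : halfBinom n * n * (r n - r 0) =
    halfBinom n * (2 * 0 - n) * r 0 + halfBinom n * (2 * n - n) * r n := by ring
  rw [hw', e', e]
  field_simp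
  ring

end Ising

/-! ### Bounded discrete harmonic functions -/

namespace Ising

/-- Discrete harmonicity at a site of the square lattice. -/
def HarmonicAt (u : ℤ → ℤ → ℝ) (i j : ℤ) : Prop :=
  4 * u i j = u (i + 1) j + u (i - 1) j + u i (j + 1) + u i (j - 1)

/-- The increment g is bounded and harmonic. If its supremum M were positive, g would stay near M
along a long horizontal run starting from a near-maximal point, and u would grow beyond its bound.
-/
theorem liouville_step {u : ℤ → ℤ → ℝ} {C : ℝ} (hb : ∀ i j, |u i j| ≤ C)
    (hu : ∀ i j, HarmonicAt u i j) (i j : ℤ) : u (i + 1) j ≤ u i j := by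
  by_contra! hlt
  set g : ℤ → ℤ → ℝ := fun i j => u (i + 1) j - u i j with hg
  have hgC : ∀ i j, g i j ≤ 2 * C := fun i j => by
    have h1 := abs_le.1 (hb (i + 1) j)
    have h2 := abs_le.1 (hb i j)
    simp only [hg]
    linarith
  have hbdd : BddAbove (Set.range fun x : ℤ × ℤ => g x.1 x.2) :=
    ⟨2 * C, by rintro _ ⟨x, rfl⟩; exact hgC _ _⟩
  set M := ⨆ x : ℤ × ℤ, g x.1 x.2 with hM
  have hle : ∀ i j, g i j ≤ M := fun i j => le_ciSup hbdd (i, j)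
  have hMpos : 0 < M := lt_of_lt_of_le (by simp only [hg]; linarith) (hle i j)
  have hharm : ∀ i j, 4 * g i j = g (i + 1) j + g (i - 1) j + g i (j + 1) + g i (j - 1) := by
    intro i j
    have h1 := hu (i + 1) j
    have h2 := hu i j
    unfold HarmonicAt at h1 h2
    simp only [hg]
    rw [show i + 1 - 1 = i - 1 + 1 by ring] at h1
    linarith
  obtain ⟨K, hK⟩ := exists_nat_gt (4 * C / M)
  have hKM : 4 * C < K * M := by rwa [div_lt_iff₀ hMpos] at hK
  -- Each step to the right multiplies the deficit from M by at most 4, so g ≥ M/2 for K steps;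
  -- their total K·M/2 exceeds 2C.
  obtain ⟨⟨x, y⟩, hxy⟩ : ∃ x : ℤ × ℤ, M - M / (2 * 4 ^ K) < g x.1 x.2 :=
    exists_lt_of_lt_ciSup (by
      have : 0 < M / (2 * 4 ^ K) := by positivity
      linarith)
  simp only at hxy
  have hstep : ∀ k : ℕ, M - 4 ^ k * (M / (2 * 4 ^ K)) ≤ g (x + k) y := by
    intro k
    induction k with
    | zero => simpa using hxy.le
    | succ k ih =>
      have h := hharm (x + k) y
      have h1 := hle (x + k - 1) y
      have h2 := hle (x + k) (y + 1)
      have h3 := hle (x + k) (y - 1)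
      push_cast
      rw [← add_assoc, pow_succ]
      linarith
  have hsum : ∀ k : ℕ, k ≤ K → k * (M / 2) ≤ u (x + k) y - u x y := by
    intro k hk
    induction k with
    | zero => simp
    | succ k ih =>
      have h := ih (by omega)
      have h1 := hstep k
      have h2 : (4 : ℝ) ^ k * (M / (2 * 4 ^ K)) ≤ M / 2 := by
        have h4 : (4 : ℝ) ^ k ≤ 4 ^ K := pow_le_pow_right₀ (by norm_num) (by omega)
        calc (4 : ℝ) ^ k * (M / (2 * 4 ^ K)) ≤ 4 ^ K * (M / (2 * 4 ^ K)) := by gcongr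
          _ = M / 2 := by field_simp
      simp only [hg] at h1
      push_cast
      rw [← add_assoc]
      linarith
  have h := hsum K le_rfl
  have h1 := abs_le.1 (hb (x + K) y)
  have h2 := abs_le.1 (hb x y)
  linarith

/-- Bounded discrete harmonic functions on the square lattice are constant. -/
theorem liouville {u : ℤ → ℤ → ℝ} {C : ℝ} (hb : ∀ i j, |u i j| ≤ C)
    (hu : ∀ i j, HarmonicAt u i j) (i j i' j' : ℤ) : u i j = u i' j' := by
  have hneg : ∀ i j, HarmonicAt (fun i j => -u i j) i j := fun i j => by
    have := hu i j
    unfold HarmonicAt at this ⊢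
    linarith
  have hswap : ∀ i j, HarmonicAt (fun i j => u j i) i j := fun i j => by
    have := hu j i
    unfold HarmonicAt at this ⊢
    linarith
  have hswapneg : ∀ i j, HarmonicAt (fun i j => -u j i) i j := fun i j => by
    have := hu j i
    unfold HarmonicAt at this ⊢
    linarith
  have h1 : ∀ i j, u (i + 1) j = u i j := fun i j =>
    le_antisymm (liouville_step hb hu i j)
      (neg_le_neg_iff.1 (liouville_step (C := C) (fun i j => by rw [abs_neg]; exact hb i j) hneg i j))
  have h2 : ∀ i j, u i (j + 1) = u i j := fun i j =>
    le_antisymm (liouville_step (C := C) (fun i j => hb j i) hswap j i)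
      (neg_le_neg_iff.1 (liouville_step (C := C) (fun i j => by rw [abs_neg]; exact hb j i) hswapneg j i))
  have h1' : ∀ i j, u i j = u 0 j := fun i j => by
    induction i using Int.induction_on with
    | zero => rfl
    | succ k ih => rw [h1, ih]
    | pred k ih => rw [← ih, ← h1]; congr 1; ring
  have h2' : ∀ j, u 0 j = u 0 0 := fun j => by
    induction j using Int.induction_on with
    | zero => rfl
    | succ k ih => rw [h2, ih]
    | pred k ih => rw [← ih, ← h2]; congr 1; ring
  rw [h1', h2', h1' i', h2' j']

/-- Uniqueness for the bounded Dirichlet problem above the diagonal. -/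
theorem eq_zero_of_harmonic_above_diagonal {u : ℤ → ℤ → ℝ} {C : ℝ}
    (hb : ∀ i j, i ≤ j → |u i j| ≤ C) (hu : ∀ i j, i < j → HarmonicAt u i j)
    (h0 : ∀ i, u i i = 0) (i j : ℤ) (hij : i ≤ j) : u i j = 0 := by
  -- Odd reflection in the diagonal gives a bounded harmonic function on the whole lattice.
  set v : ℤ → ℤ → ℝ := fun i j => if i ≤ j then u i j else -u j i with hv
  have hvb : ∀ i j, |v i j| ≤ C := fun i j => by
    simp only [hv]
    split_ifs with h
    · exact hb i j h
    · rw [abs_neg]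
      exact hb j i (by omega)
  have habove : ∀ i j, i ≤ j → v i j = u i j := fun i j h => if_pos h
  have hbelow : ∀ i j, j ≤ i → v i j = -u j i := fun i j h => by
    rcases h.lt_or_eq with h | rfl
    · exact if_neg (by omega)
    · simp [hv, h0]
  have hharm : ∀ i j, HarmonicAt v i j := by
    intro i j
    unfold HarmonicAt
    rcases lt_trichotomy i j with h | rfl | h
    · rw [habove i j h.le, habove (i + 1) j (by omega), habove (i - 1) j (by omega),
        habove i (j + 1) (by omega), habove i (j - 1) (by omega)]
      exact hu i j h
    · rw [habove i i le_rfl, hbelow (i + 1) i (by omega), habove (i - 1) i (by omega),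
        habove i (i + 1) (by omega), hbelow i (i - 1) (by omega), h0]
      ring
    · rw [hbelow i j h.le, hbelow (i + 1) j (by omega), hbelow (i - 1) j (by omega),
        hbelow i (j + 1) (by omega), hbelow i (j - 1) (by omega)]
      have := hu j i h
      unfold HarmonicAt at this
      linarith
  have := liouville hvb hharm i j i i
  rw [habove i j hij, habove i i le_rfl, h0] at this
  exact this

/-! ### Poisson kernel and Dirichlet-to-Neumann map above the diagonal -/

noncomputable section

/-- The decay rate, in the direction orthogonal to the diagonal, of the harmonic function with
frequency `s` along the diagonal. -/
def decay (s : ℝ) : ℝ := Real.cos s / (1 + |Real.sin s|)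

theorem one_add_abs_sin_pos (s : ℝ) : 0 < 1 + |Real.sin s| := by positivity

theorem continuous_decay : Continuous decay := by
  unfold decay
  exact Real.continuous_cos.div (by fun_prop) fun s => (one_add_abs_sin_pos s).ne'

theorem abs_decay_le (s : ℝ) : |decay s| ≤ 1 := by
  unfold decay
  rw [abs_div, abs_of_pos (one_add_abs_sin_pos s), div_le_one (one_add_abs_sin_pos s)]
  have := Real.abs_cos_le_one s
  have := abs_nonneg (Real.sin s)
  linarith

/-- This identifies |sin s| as the symbol of the normal derivative on the diagonal. -/
theorem cos_mul_decay (s : ℝ) : Real.cos s * decay s = 1 - |Real.sin s| := by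
  unfold decay
  have h := (one_add_abs_sin_pos s).ne'
  have h2 := sq_abs (Real.sin s)
  have h3 := Real.sin_sq_add_cos_sq s
  field_simp
  nlinarith

/-- This quadratic equation for λ is exactly harmonicity of the mode cos((i+j)s) λ^(j-i); `decay s`
is its root of modulus at most 1. -/
theorem cos_mul_one_add_decay_sq (s : ℝ) : Real.cos s * (1 + decay s ^ 2) = 2 * decay s := by
  have h := cos_mul_decay s
  have h1 : decay s * (1 + |Real.sin s|) = Real.cos s := by
    unfold decay
    exact div_mul_cancel₀ _ (one_add_abs_sin_pos s).ne'
  linear_combination decay s * h - h1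

/-- The Poisson kernel of the half-plane above the diagonal. -/
def poissonKernel (i j : ℤ) : ℝ :=
  (1 / Real.pi) * ∫ s in (-(Real.pi / 2))..(Real.pi / 2),
    Real.cos ((i + j : ℤ) * s) * decay s ^ (j - i).toNat

theorem abs_poissonKernel_le (i j : ℤ) : |poissonKernel i j| ≤ 1 := by
  unfold poissonKernel
  have h : ‖∫ s in (-(Real.pi / 2))..(Real.pi / 2),
      Real.cos ((i + j : ℤ) * s) * decay s ^ (j - i).toNat‖ ≤
      1 * |Real.pi / 2 - -(Real.pi / 2)| := by
    refine intervalIntegral.norm_integral_le_of_norm_le_const fun s _ => ?_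
    rw [Real.norm_eq_abs, abs_mul, abs_pow]
    exact mul_le_one₀ (Real.abs_cos_le_one _) (by positivity)
      (pow_le_one₀ (abs_nonneg _) (abs_decay_le s))
  rw [show Real.pi / 2 - -(Real.pi / 2) = Real.pi by ring, abs_of_pos Real.pi_pos, one_mul,
    Real.norm_eq_abs] at h
  rw [abs_mul, abs_of_pos (by positivity : 0 < 1 / Real.pi), one_div, inv_mul_le_iff₀ Real.pi_pos,
    mul_one]
  exact h

theorem poissonKernel_harmonic (i j : ℤ) (hij : i < j) : HarmonicAt poissonKernel i j := by
  obtain ⟨q, hq⟩ : ∃ q : ℕ, j - i = q + 1 := ⟨(j - i - 1).toNat, by omega⟩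
  unfold HarmonicAt poissonKernel
  rw [show (j - i).toNat = q + 1 by omega, show (j - (i + 1)).toNat = q by omega,
    show (j - (i - 1)).toNat = q + 2 by omega, show (j + 1 - i).toNat = q + 2 by omega,
    show (j - 1 - i).toNat = q by omega, ← mul_add, ← mul_add, ← mul_add, mul_left_comm]
  congr 1
  rw [← intervalIntegral.integral_add, ← intervalIntegral.integral_add,
    ← intervalIntegral.integral_add, ← intervalIntegral.integral_const_mul]
  · refine intervalIntegral.integral_congr fun s _ => ?_
    have h := cos_mul_one_add_decay_sq s
    push_cast
    rw [show ((i : ℝ) + 1 + j) * s = (i + j) * s + s by ring,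
      show ((i : ℝ) - 1 + j) * s = (i + j) * s - s by ring,
      show ((i : ℝ) + (j + 1)) * s = (i + j) * s + s by ring,
      show ((i : ℝ) + (j - 1)) * s = (i + j) * s - s by ring, Real.cos_add, Real.cos_sub]
    linear_combination (-2 * Real.cos ((i + j) * s) * decay s ^ q) * h
  all_goals
    refine Continuous.intervalIntegrable ?_ _ _
    have := continuous_decay
    fun_prop

theorem poissonKernel_diag (k : ℤ) : poissonKernel k k = if k = 0 then 1 else 0 := by
  unfold poissonKernel
  simp only [sub_self, Int.toNat_zero, pow_zero, mul_one]
  split_ifs with h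
  · subst h
    simp only [add_zero, Int.cast_zero, zero_mul, Real.cos_zero, intervalIntegral.integral_const,
      smul_eq_mul, mul_one]
    rw [show Real.pi / 2 - -(Real.pi / 2) = Real.pi by ring]
    exact one_div_mul_cancel Real.pi_ne_zero
  · have hk : ((k + k : ℤ) : ℝ) ≠ 0 := by exact_mod_cast (by omega : k + k ≠ 0)
    rw [intervalIntegral.integral_comp_mul_left (fun x => Real.cos x) hk, integral_cos]
    have e : ((k + k : ℤ) : ℝ) * (Real.pi / 2) = k * Real.pi := by push_cast; ring
    rw [mul_neg, Real.sin_neg, e, Real.sin_int_mul_pi]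
    simp

theorem integral_cos_mul_sin (k : ℤ) :
    ∫ s in (0 : ℝ)..(Real.pi / 2), Real.cos (2 * k * s) * Real.sin s = 1 / (1 - 4 * (k : ℝ) ^ 2) := by
  have h1 : (2 * (k : ℝ) + 1) ≠ 0 := by exact_mod_cast (by omega : 2 * k + 1 ≠ 0)
  have h2 : (2 * (k : ℝ) - 1) ≠ 0 := by exact_mod_cast (by omega : 2 * k - 1 ≠ 0)
  have hd : ∀ s ∈ Set.uIcc (0 : ℝ) (Real.pi / 2), HasDerivAt
      (fun s : ℝ => -Real.cos ((2 * k + 1) * s) / (2 * (2 * k + 1)) +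
        Real.cos ((2 * k - 1) * s) / (2 * (2 * k - 1)))
      (Real.cos (2 * k * s) * Real.sin s) s := by
    intro s _
    have e1 : HasDerivAt (fun s : ℝ => (2 * (k : ℝ) + 1) * s) (2 * k + 1) s := by
      simpa using (hasDerivAt_id s).const_mul (2 * (k : ℝ) + 1)
    have e2 : HasDerivAt (fun s : ℝ => (2 * (k : ℝ) - 1) * s) (2 * k - 1) s := by
      simpa using (hasDerivAt_id s).const_mul (2 * (k : ℝ) - 1)
    refine ((e1.cos.neg.div_const _).add (e2.cos.div_const _)).congr_deriv ?_
    rw [show (2 * (k : ℝ) + 1) * s = 2 * k * s + s by ring,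
      show (2 * (k : ℝ) - 1) * s = 2 * k * s - s by ring, Real.sin_add, Real.sin_sub]
    field_simp
    ring
  rw [intervalIntegral.integral_eq_sub_of_hasDerivAt hd
    (Continuous.intervalIntegrable (by fun_prop) _ _)]
  have c1 : Real.cos ((2 * k + 1) * (Real.pi / 2)) = 0 :=
    Real.cos_eq_zero_iff.2 ⟨k, by ring⟩
  have c2 : Real.cos ((2 * k - 1) * (Real.pi / 2)) = 0 :=
    Real.cos_eq_zero_iff.2 ⟨k - 1, by push_cast; ring⟩
  rw [c1, c2, show 1 - 4 * (k : ℝ) ^ 2 = -(2 * k + 1) * (2 * k - 1) by ring]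
  simp only [mul_zero, Real.cos_zero]
  field_simp
  ring

theorem integral_cos_mul_abs_sin (k : ℤ) :
    ∫ s in (-(Real.pi / 2))..(Real.pi / 2), Real.cos (2 * k * s) * |Real.sin s| =
      2 / (1 - 4 * (k : ℝ) ^ 2) := by
  have hc : ∀ a b : ℝ, IntervalIntegrable (fun s : ℝ => Real.cos (2 * k * s) * |Real.sin s|)
      MeasureTheory.volume a b := fun a b => Continuous.intervalIntegrable (by fun_prop) _ _
  have hp : ∫ s in (0 : ℝ)..(Real.pi / 2), Real.cos (2 * k * s) * |Real.sin s| =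
      1 / (1 - 4 * (k : ℝ) ^ 2) := by
    rw [← integral_cos_mul_sin]
    refine intervalIntegral.integral_congr fun s hs => ?_
    rw [Set.uIcc_of_le (by positivity)] at hs
    have : 0 ≤ Real.sin s :=
      Real.sin_nonneg_of_nonneg_of_le_pi hs.1 (by linarith [hs.2, Real.pi_pos])
    simp only [abs_of_nonneg this]
  have hn : ∫ s in (-(Real.pi / 2))..(0 : ℝ), Real.cos (2 * k * s) * |Real.sin s| =
      1 / (1 - 4 * (k : ℝ) ^ 2) := by
    rw [← hp, ← neg_zero, ← intervalIntegral.integral_comp_neg]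
    simp
  rw [← intervalIntegral.integral_add_adjacent_intervals (hc _ 0) (hc 0 _), hn, hp]
  ring

/-- Averaging the two neighbours above the diagonal multiplies the mode cos(2ks) by cos s · `decay
s`, so the difference has symbol |sin s|, whose Fourier coefficients are the right-hand side. -/
theorem poissonKernel_normal (k : ℤ) :
    poissonKernel k k - (poissonKernel (k - 1) k + poissonKernel k (k + 1)) / 2 =
      2 / Real.pi / (1 - 4 * (k : ℝ) ^ 2) := by
  unfold poissonKernel
  rw [show (k - k).toNat = 0 by omega, show (k - (k - 1)).toNat = 1 by omega,
    show (k + 1 - k).toNat = 1 by omega, ← mul_add, mul_div_assoc, ← mul_sub,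
    ← intervalIntegral.integral_add, ← intervalIntegral.integral_div,
    ← intervalIntegral.integral_sub]
  · rw [show 2 / Real.pi / (1 - 4 * (k : ℝ) ^ 2) = 1 / Real.pi * (2 / (1 - 4 * (k : ℝ) ^ 2)) by
      ring, ← integral_cos_mul_abs_sin]
    congr 1
    refine intervalIntegral.integral_congr fun s _ => ?_
    have h := cos_mul_decay s
    push_cast
    rw [show ((k : ℝ) - 1 + k) * s = 2 * k * s - s by ring,
      show ((k : ℝ) + (k + 1)) * s = 2 * k * s + s by ring,
      show ((k : ℝ) + k) * s = 2 * k * s by ring, Real.cos_add, Real.cos_sub]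
    linear_combination (-Real.cos (2 * k * s)) * h
  all_goals
    refine Continuous.intervalIntegrable ?_ _ _
    have := continuous_decay
    fun_prop

/-- The Dirichlet-to-Neumann map of the half-plane above the diagonal, for finitely supported
boundary values. -/
theorem normal_derivative_eq {S : ℤ → ℤ → ℝ} {C : ℝ} (hb : ∀ i j, i ≤ j → |S i j| ≤ C)
    (hS : ∀ i j, i < j → HarmonicAt S i j) (a : ℤ) (n : ℕ)
    (h0 : ∀ k, k < a ∨ a + n < k → S k k = 0) (k : ℤ) :
    S k k - (S (k - 1) k + S k (k + 1)) / 2 =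
      2 / Real.pi * ∑ l ∈ Finset.range (n + 1),
        S (a + l) (a + l) / (1 - 4 * ((k : ℝ) - a - l) ^ 2) := by
  -- Subtracting the Poisson extension of the boundary values leaves a bounded solution with zero
  -- boundary data, hence zero.
  set u : ℤ → ℤ → ℝ := fun i j => S i j - ∑ l ∈ Finset.range (n + 1),
    S (a + l) (a + l) * poissonKernel (i - a - l) (j - a - l) with hu
  have hharm : ∀ i j, i < j → HarmonicAt u i j := by
    intro i j hij
    have hSij := hS i j hij
    unfold HarmonicAt at hSij ⊢
    simp only [hu]
    have hP : ∀ l ∈ Finset.range (n + 1),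
        4 * (S (a + l) (a + l) * poissonKernel (i - a - l) (j - a - l)) =
        S (a + l) (a + l) * poissonKernel (i + 1 - a - l) (j - a - l) +
        S (a + l) (a + l) * poissonKernel (i - 1 - a - l) (j - a - l) +
        S (a + l) (a + l) * poissonKernel (i - a - l) (j + 1 - a - l) +
        S (a + l) (a + l) * poissonKernel (i - a - l) (j - 1 - a - l) := by
      intro l _
      have := poissonKernel_harmonic (i - a - l) (j - a - l) (by omega)
      unfold HarmonicAt at this
      rw [show i + 1 - a - l = i - a - l + 1 by ring, show i - 1 - a - l = i - a - l - 1 by ring,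
        show j + 1 - a - l = j - a - l + 1 by ring, show j - 1 - a - l = j - a - l - 1 by ring]
      linear_combination S (a + l) (a + l) * this
    have hP' := Finset.sum_congr rfl hP
    rw [← Finset.mul_sum, Finset.sum_add_distrib, Finset.sum_add_distrib,
      Finset.sum_add_distrib] at hP'
    linarith
  have hdiag : ∀ i, u i i = 0 := by
    intro i
    simp only [hu, poissonKernel_diag]
    by_cases hi : i < a ∨ a + n < i
    · rw [h0 i hi, Finset.sum_eq_zero, sub_zero]
      intro l hl
      rw [if_neg, mul_zero]
      have := Finset.mem_range.1 hl
      omega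
    · rw [Finset.sum_eq_single (i - a).toNat]
      · rw [if_pos (by omega), show a + ((i - a).toNat : ℤ) = i by omega]
        ring
      · intro l _ hl
        rw [if_neg (by omega), mul_zero]
      · intro h
        exact absurd (Finset.mem_range.2 (by omega)) h
  have hbound : ∀ i j, i ≤ j → |u i j| ≤ C + ∑ l ∈ Finset.range (n + 1), |S (a + l) (a + l)| := by
    intro i j hij
    refine (abs_sub _ _).trans (add_le_add (hb i j hij) ?_)
    refine (Finset.abs_sum_le_sum_abs _ _).trans (Finset.sum_le_sum fun l _ => ?_)
    rw [abs_mul]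
    exact mul_le_of_le_one_right (abs_nonneg _) (abs_poissonKernel_le _ _)
  have huz := eq_zero_of_harmonic_above_diagonal hbound hharm hdiag
  have hval : ∀ i j, i ≤ j → S i j = ∑ l ∈ Finset.range (n + 1),
      S (a + l) (a + l) * poissonKernel (i - a - l) (j - a - l) := fun i j hij =>
    sub_eq_zero.1 (huz i j hij)
  rw [hval k k le_rfl, hval (k - 1) k (by omega), hval k (k + 1) (by omega), Finset.mul_sum,
    ← Finset.sum_add_distrib, Finset.sum_div, ← Finset.sum_sub_distrib]
  refine Finset.sum_congr rfl fun l _ => ?_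
  have := poissonKernel_normal (k - a - l)
  push_cast at this
  rw [show k - 1 - a - l = k - a - l - 1 by ring, show k + 1 - a - l = k - a - l + 1 by ring]
  linear_combination S (a + l) (a + l) * this

end

end Ising

/-! ### Mixed spin-disorder correlations and their local relations -/

namespace Ising

/-- The horizontal edge to the right of `(x, y)`. -/
abbrev hEdge (x y : ℤ) : Site × Site := ((x, y), (x + 1, y))

/-- The vertical edge above `(x, y)`. -/
abbrev vEdge (x y : ℤ) : Site × Site := ((x, y), (x, y + 1))

/-- The edges with exactly one endpoint in `W`. -/
def edgeBoundary (W : Finset Site) : Finset (Site × Site) :=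
  (edges W).filter fun e => ¬(e.1 ∈ W ∧ e.2 ∈ W)

theorem mem_edgeBoundary (W : Finset Site) (x y z w : ℤ) :
    ((x, y), (z, w)) ∈ edgeBoundary W ↔
      ((z = x + 1 ∧ w = y) ∨ (z = x ∧ w = y + 1)) ∧
        (((x, y) ∈ W ∧ (z, w) ∉ W) ∨ ((z, w) ∈ W ∧ (x, y) ∉ W)) := by
  simp only [edgeBoundary, Finset.mem_filter, mem_edges, Prod.mk_add_mk, Prod.mk.injEq, add_zero]
  tauto

/-- The sign `-1` if `p` holds and `1` otherwise. -/
def signIf (p : Prop) [Decidable p] : ℝ := if p then -1 else 1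

theorem signIf_mul_self (p : Prop) [Decidable p] : signIf p * signIf p = 1 := by
  unfold signIf
  split_ifs <;> norm_num

theorem signIf_of {p : Prop} [Decidable p] (h : p) : signIf p = -1 := if_pos h

theorem signIf_of_not {p : Prop} [Decidable p] (h : ¬p) : signIf p = 1 := if_neg h

theorem signIf_congr {p q : Prop} [Decidable p] [Decidable q] (h : p ↔ q) :
    signIf p = signIf q := by
  unfold signIf
  simp only [h]

theorem prod_symmDiff_of_mul_self {f : Site → ℝ} (hf : ∀ x, f x * f x = 1) (A B : Finset Site) :
    ∏ x ∈ A ∆ B, f x = (∏ x ∈ A, f x) * ∏ x ∈ B, f x := by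
  have h1 : ∏ x ∈ A, f x = (∏ x ∈ A \ B, f x) * ∏ x ∈ A ∩ B, f x := by
    rw [mul_comm, Finset.prod_inter_mul_prod_sdiff]
  have h2 : ∏ x ∈ B, f x = (∏ x ∈ B \ A, f x) * ∏ x ∈ A ∩ B, f x := by
    rw [mul_comm, Finset.inter_comm, Finset.prod_inter_mul_prod_sdiff]
  have h3 : (∏ x ∈ A ∩ B, f x) * ∏ x ∈ A ∩ B, f x = 1 := by
    rw [← Finset.prod_mul_distrib]
    exact Finset.prod_eq_one fun x _ => hf x
  have h4 : A ∆ B = A \ B ∪ B \ A := rfl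
  rw [h4, Finset.prod_union disjoint_sdiff_sdiff, h1, h2]
  linear_combination (-(∏ x ∈ A \ B, f x) * ∏ x ∈ B \ A, f x) * h3

/-- The sign acquired by the product of the spins in `A` when the spins in `W` are flipped. -/
def flipSign (W A : Finset Site) : ℝ := ∏ x ∈ A, signIf (x ∈ W)

theorem flipSign_symmDiff (W A B : Finset Site) :
    flipSign W (A ∆ B) = flipSign W A * flipSign W B :=
  prod_symmDiff_of_mul_self (fun _ => signIf_mul_self _) A B

theorem flipSign_singleton (W : Finset Site) (x : Site) : flipSign W {x} = signIf (x ∈ W) :=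
  Finset.prod_singleton _ _

theorem flipSign_empty (W : Finset Site) : flipSign W ∅ = 1 := Finset.prod_empty

/-- The relations satisfied in infinite volume, at the critical point, by the mixed correlations
`F E A` of the spins at the sites in `A` with the disorder operators whose disorder lines cross the
edges in `E`. -/
structure IsCriticalState (F : Finset (Site × Site) → Finset Site → ℝ) : Prop where
  abs_le_one : ∀ E A, |F E A| ≤ 1
  empty_empty : F ∅ ∅ = 1
  hEdge_rule : ∀ E A x y, F (E ∆ {hEdge x y}) A =
    √2 * F E A - signIf (hEdge x y ∈ E) * F E (A ∆ {(x, y)} ∆ {(x + 1, y)})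
  vEdge_rule : ∀ E A x y, F (E ∆ {vEdge x y}) A =
    √2 * F E A - signIf (vEdge x y ∈ E) * F E (A ∆ {(x, y)} ∆ {(x, y + 1)})
  flip_rule : ∀ E A W, F (E ∆ edgeBoundary W) A = flipSign W A * F E A

/-- The edges crossed by the path on the dual lattice that joins the face `(i, j)` to the face
`(m, m)`, first along the row `j` and then along the column `m`. Faces are labelled by their lower
left corner. -/
noncomputable def cutPath (m i j : ℤ) : Finset (Site × Site) :=
  ((Finset.Ioc (min i m) (max i m)).image fun x => vEdge x j) ∪
    ((Finset.Ioc (min j m) (max j m)).image fun y => hEdge m y)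

theorem mem_cutPath (m i j x y z w : ℤ) :
    ((x, y), (z, w)) ∈ cutPath m i j ↔
      (z = x ∧ w = y + 1 ∧ y = j ∧ (i < x ∧ x ≤ m ∨ m < x ∧ x ≤ i)) ∨
        (z = x + 1 ∧ w = y ∧ x = m ∧ (j < y ∧ y ≤ m ∨ m < y ∧ y ≤ j)) := by
  simp only [cutPath, hEdge, vEdge, Finset.mem_union, Finset.mem_image, Finset.mem_Ioc,
    Prod.mk.injEq]
  constructor
  · rintro (⟨x', h, ⟨rfl, rfl⟩, rfl, rfl⟩ | ⟨y', h, ⟨rfl, rfl⟩, rfl, rfl⟩)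
    · left; omega
    · right; omega
  · rintro (⟨rfl, rfl, rfl, h⟩ | ⟨rfl, rfl, rfl, h⟩)
    · exact Or.inl ⟨z, by omega, ⟨rfl, rfl⟩, rfl, rfl⟩
    · exact Or.inr ⟨w, by omega, ⟨rfl, rfl⟩, rfl, rfl⟩

/-- The sites of the row `y` between the columns `i` and `m`. -/
noncomputable def rowStrip (m i y : ℤ) : Finset Site := (Finset.Ioc (min i m) (max i m)).image fun x => (x, y)

theorem mem_rowStrip (m i y x z : ℤ) :
    (x, z) ∈ rowStrip m i y ↔ z = y ∧ (i < x ∧ x ≤ m ∨ m < x ∧ x ≤ i) := by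
  simp only [rowStrip, Finset.mem_image, Finset.mem_Ioc, Prod.mk.injEq]
  constructor
  · rintro ⟨x', h, rfl, rfl⟩
    omega
  · rintro ⟨rfl, h⟩
    exact ⟨x, by omega, rfl, rfl⟩

theorem cutPath_self (m : ℤ) : cutPath m m m = ∅ := by
  simp [cutPath]

theorem cutPath_right (m i j : ℤ) : cutPath m i j ∆ {vEdge (i + 1) j} = cutPath m (i + 1) j := by
  ext ⟨⟨x, y⟩, ⟨z, w⟩⟩
  simp only [Finset.mem_symmDiff, mem_cutPath, Finset.mem_singleton, Prod.mk.injEq]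
  omega

theorem cutPath_left (m i j : ℤ) : cutPath m i j ∆ {vEdge i j} = cutPath m (i - 1) j := by
  have := cutPath_right m (i - 1) j
  rw [sub_add_cancel] at this
  rw [← this, symmDiff_symmDiff_cancel_right]

/-- Extending the path upwards differs from the standard path to the new face by a closed dual
contour around a strip of sites, which `flip_rule` converts into a sign. -/
theorem cutPath_up (m i j : ℤ) : cutPath m i j ∆ {hEdge i (j + 1)} =
    cutPath m i (j + 1) ∆ edgeBoundary (rowStrip m i (j + 1)) := by
  have hP : ∀ m i x : ℤ, (i < x ∧ x ≤ m ∨ m < x ∧ x ≤ i) ↔ x ∈ Finset.Ioc (min i m) (max i m) := by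
    intro m i x
    rw [Finset.mem_Ioc]
    omega
  have key1 : ∀ x, ((x ∈ Finset.Ioc (min i m) (max i m) ∧ x + 1 ∉ Finset.Ioc (min i m) (max i m)) ∨
      (x + 1 ∈ Finset.Ioc (min i m) (max i m) ∧ x ∉ Finset.Ioc (min i m) (max i m))) ↔
      ((x = i ∧ x ≠ m) ∨ (x = m ∧ x ≠ i)) := by
    intro x
    rw [← hP, ← hP]
    omega
  have key2 : ∀ y, y ∈ Finset.Ioc (min (j + 1) m) (max (j + 1) m) ↔
      ((y ∈ Finset.Ioc (min j m) (max j m) ∧ y ≠ j + 1) ∨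
        (y ∉ Finset.Ioc (min j m) (max j m) ∧ y = j + 1)) := by
    intro y
    rw [← hP, ← hP]
    omega
  ext ⟨⟨x, y⟩, ⟨z, w⟩⟩
  simp only [Finset.mem_symmDiff, mem_cutPath, Finset.mem_singleton, Prod.mk.injEq,
    mem_edgeBoundary, mem_rowStrip, hP, key2]
  generalize Finset.Ioc (min i m) (max i m) = I at key1
  generalize Finset.Ioc (min j m) (max j m) = J
  by_cases hh : z = x + 1 ∧ w = y
  · obtain ⟨rfl, rfl⟩ := hh
    have := key1 x
    have e1 : x + 1 ≠ x := by omega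
    have e2 : w ≠ w + 1 := by omega
    have e3 : (x + 1 = i + 1) = (x = i) := by simp
    simp only [e1, e2, e3, false_and, and_false, false_or, true_and, or_false, and_true]
    generalize (x ∈ I) = a at *
    generalize (x + 1 ∈ I) = b at *
    generalize (w ∈ J) = c at *
    clear key1 key2 hP
    grind
  · by_cases hv : z = x ∧ w = y + 1
    · obtain ⟨rfl, rfl⟩ := hv
      have e1 : z ≠ z + 1 := by omega
      have e2 : y + 1 ≠ y := by omega
      have e3 : (y + 1 = j + 1) = (y = j) := by simp
      have e4 : y = j → y ≠ j + 1 := by omega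
      have e5 : z = i → z ≠ i + 1 := by omega
      simp only [e1, e2, e3, false_and, and_false, false_or, true_and, or_false]
      generalize (z ∈ I) = a at *
      clear key1 key2 hP hh
      generalize (y = j) = b at *
      generalize (y = j + 1) = c at *
      grind
    · have e3 : z = i + 1 → x = i → z = x + 1 := by omega
      have e4 : w = j + 1 → y = j + 1 → w = y := by omega
      clear key1 key2 hP
      simp only [hh, hv]
      grind

theorem cutPath_down (m i j : ℤ) : cutPath m i j ∆ {hEdge i j} =
    cutPath m i (j - 1) ∆ edgeBoundary (rowStrip m i j) := by
  have := cutPath_up m i (j - 1)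
  rw [sub_add_cancel] at this
  rw [← symmDiff_symmDiff_cancel_right (edgeBoundary (rowStrip m i j)) (cutPath m i j), ← this,
    symmDiff_right_comm, symmDiff_symmDiff_cancel_right]

variable {F : Finset (Site × Site) → Finset Site → ℝ}

/-- The four edges at a site form its edge boundary, so the two ways around the site differ by a
spin flip there. -/
theorem star_split (E : Finset (Site × Site)) (x y : ℤ) :
    E ∆ {hEdge x y} ∆ {vEdge x (y - 1)} =
      (E ∆ {vEdge x y} ∆ {hEdge (x - 1) y}) ∆ edgeBoundary {(x, y)} := by
  have : ({hEdge x y} : Finset (Site × Site)) ∆ {vEdge x (y - 1)} =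
      ({vEdge x y} ∆ {hEdge (x - 1) y}) ∆ edgeBoundary {(x, y)} := by
    ext ⟨⟨x', y'⟩, ⟨z, w⟩⟩
    simp only [Finset.mem_symmDiff, Finset.mem_singleton, Prod.mk.injEq, mem_edgeBoundary]
    omega
  rw [symmDiff_assoc, this]
  simp only [symmDiff_assoc]

/-- The relation between the values of a fermionic observable at a corner of a face and at the four
nearest corners with the same orientation. -/
theorem IsCriticalState.local_relation (hF : IsCriticalState F) (E : Finset (Site × Site))
    (A : Finset Site) (x y : ℤ) :
    4 * F E (A ∆ {(x, y)}) =
      signIf (hEdge x y ∈ E) * F (E ∆ {vEdge (x + 1) y}) (A ∆ {(x + 1, y)}) +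
      signIf (hEdge (x - 1) y ∈ E) * F (E ∆ {vEdge x y}) (A ∆ {(x - 1, y)}) +
      signIf (vEdge x y ∈ E) * F (E ∆ {hEdge x (y + 1)}) (A ∆ {(x, y + 1)}) +
      signIf (vEdge x (y - 1) ∈ E) * F (E ∆ {hEdge x y}) (A ∆ {(x, y - 1)}) +
      (signIf (vEdge x y ∈ E) * signIf (hEdge x (y + 1) ∈ E) +
        signIf (hEdge x y ∈ E) * signIf (vEdge (x + 1) y ∈ E)) * F E (A ∆ {(x + 1, y + 1)}) +
      (1 + flipSign {(x, y)} (A ∆ {(x, y)})) *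
        F (E ∆ {vEdge x y} ∆ {hEdge (x - 1) y}) (A ∆ {(x, y)}) := by
  -- The routes around (x, y) through up-left and right-down each contribute √2 · √2 = 2 times the
  -- central value, and `hG` compares their ends. The rules `hR` and `hU` remove the remaining terms
  -- with a single √2.
  have hR := hF.vEdge_rule E (A ∆ {(x + 1, y)}) (x + 1) y
  have hU := hF.hEdge_rule E (A ∆ {(x, y + 1)}) x (y + 1)
  have hL1 := hF.vEdge_rule E (A ∆ {(x, y)}) x y
  have hL2 := hF.hEdge_rule (E ∆ {vEdge x y}) (A ∆ {(x, y)}) (x - 1) y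
  have hD1 := hF.hEdge_rule E (A ∆ {(x, y)}) x y
  have hD2 := hF.vEdge_rule (E ∆ {hEdge x y}) (A ∆ {(x, y)}) x (y - 1)
  have hW : signIf (hEdge (x - 1) y ∈ E ∆ {vEdge x y}) = signIf (hEdge (x - 1) y ∈ E) := by
    refine signIf_congr ?_
    simp only [Finset.mem_symmDiff, Finset.mem_singleton, Prod.mk.injEq]
    constructor
    · rintro (h | h)
      · exact h.1
      · omega
    · exact fun h => Or.inl ⟨h, by omega⟩
  have hS : signIf (vEdge x (y - 1) ∈ E ∆ {hEdge x y}) = signIf (vEdge x (y - 1) ∈ E) := by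
    refine signIf_congr ?_
    simp only [Finset.mem_symmDiff, Finset.mem_singleton, Prod.mk.injEq]
    constructor
    · rintro (h | h)
      · exact h.1
      · omega
    · exact fun h => Or.inl ⟨h, by omega⟩
  have hG := hF.flip_rule (E ∆ {vEdge x y} ∆ {hEdge (x - 1) y}) (A ∆ {(x, y)}) {(x, y)}
  rw [← star_split, hD2, hS] at hG
  rw [hW] at hL2
  have h2 : √2 * √2 = 2 := Real.mul_self_sqrt (by norm_num)
  rw [symmDiff_symmDiff_cancel_right] at hR hL1 hD1
  rw [symmDiff_symmDiff_cancel_right] at hU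
  simp only [sub_add_cancel] at hL2 hG
  rw [symmDiff_right_comm A, symmDiff_symmDiff_cancel_right] at hL2
  rw [symmDiff_right_comm A, symmDiff_symmDiff_cancel_right] at hG
  rw [hL1] at hL2
  rw [hD1] at hG
  have s1 := signIf_mul_self (hEdge x y ∈ E)
  have s2 := signIf_mul_self (vEdge x y ∈ E)
  rw [hR, hU]
  linear_combination hG - hL2 - 2 * F E (A ∆ {(x, y)}) * h2

end Ising

/-! ### Fermionic observable and recursion for the diagonal correlations -/

namespace Ising

noncomputable section

/-- The fermionic observable with branchings at the site `(a, a)` and at the face `(m, m)`,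
evaluated at the corner formed by the face `(i, j)` and its lower left vertex. -/
def cornerObs (F : Finset (Site × Site) → Finset Site → ℝ) (a m i j : ℤ) : ℝ :=
  F (cutPath m i j) ({(a, a)} ∆ {(i, j)})

variable {F : Finset (Site × Site) → Finset Site → ℝ}

theorem cornerObs_diag_left (a m : ℤ) : cornerObs F a m a a = F (cutPath m a a) ∅ := by
  rw [cornerObs, symmDiff_self, Finset.bot_eq_empty]

theorem cornerObs_diag_right (a m : ℤ) : cornerObs F a m m m = F ∅ ({(a, a)} ∆ {(m, m)}) := by
  rw [cornerObs, cutPath_self]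

theorem hEdge_mem_cutPath (m i j x y : ℤ) :
    hEdge x y ∈ cutPath m i j ↔ x = m ∧ (j < y ∧ y ≤ m ∨ m < y ∧ y ≤ j) := by
  rw [mem_cutPath]
  omega

theorem vEdge_mem_cutPath (m i j x y : ℤ) :
    vEdge x y ∈ cutPath m i j ↔ y = j ∧ (i < x ∧ x ≤ m ∨ m < x ∧ x ≤ i) := by
  rw [mem_cutPath]
  omega

/-- The local relation along the standard paths. The signs are branch cuts going up from the face
(m, m) and left from the site (a, a). The two non-nearest terms cancel except at the branch points,
where they become pure spin and pure disorder correlations one diagonal step longer. -/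
theorem IsCriticalState.cornerObs_relation (hF : IsCriticalState F) {a m : ℤ} (ham : a ≤ m)
    (i j : ℤ) :
    4 * cornerObs F a m i j =
      signIf (i = m ∧ m < j) * cornerObs F a m (i + 1) j +
      signIf (i - 1 = m ∧ m < j) * cornerObs F a m (i - 1) j +
      signIf (j + 1 = a ∧ i < a) * cornerObs F a m i (j + 1) +
      signIf (j = a ∧ i < a) * cornerObs F a m i (j - 1) +
      (if i = m ∧ j = m then 2 * F ∅ ({(a, a)} ∆ {(m + 1, m + 1)}) else 0) +
      (if i = a ∧ j = a then 2 * F (cutPath m (a - 1) (a - 1)) ∅ else 0) := by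
  have h := hF.local_relation (cutPath m i j) {(a, a)} i j
  have hD : signIf (hEdge i j ∈ cutPath m i j) = signIf (i = m ∧ m < j) :=
    signIf_congr (by rw [hEdge_mem_cutPath]; omega)
  have hW : signIf (hEdge (i - 1) j ∈ cutPath m i j) = signIf (i - 1 = m ∧ m < j) :=
    signIf_congr (by rw [hEdge_mem_cutPath]; omega)
  have hL : signIf (vEdge i j ∈ cutPath m i j) = signIf (m < i) :=
    signIf_congr (by rw [vEdge_mem_cutPath]; omega)
  have hS : signIf (vEdge i (j - 1) ∈ cutPath m i j) = 1 :=
    signIf_of_not (by rw [vEdge_mem_cutPath]; omega)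
  have hU : signIf (hEdge i (j + 1) ∈ cutPath m i j) = signIf (i = m ∧ j < m) :=
    signIf_congr (by rw [hEdge_mem_cutPath]; omega)
  have hR : signIf (vEdge (i + 1) j ∈ cutPath m i j) = signIf (i < m) :=
    signIf_congr (by rw [vEdge_mem_cutPath]; omega)
  have fU : flipSign (rowStrip m i (j + 1)) ({(a, a)} ∆ {(i, j + 1)}) =
      signIf (j + 1 = a ∧ i < a) * signIf (m < i) := by
    rw [flipSign_symmDiff, flipSign_singleton, flipSign_singleton]
    congr 1 <;> refine signIf_congr ?_ <;> rw [mem_rowStrip] <;> omega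
  have fD : flipSign (rowStrip m i j) ({(a, a)} ∆ {(i, j - 1)}) = signIf (j = a ∧ i < a) := by
    rw [flipSign_symmDiff, flipSign_singleton, flipSign_singleton,
      signIf_of_not (p := (i, j - 1) ∈ rowStrip m i j) (by rw [mem_rowStrip]; omega), mul_one]
    exact signIf_congr (by rw [mem_rowStrip]; omega)
  have hcoef : (signIf (m < i) * signIf (i = m ∧ j < m) + signIf (i = m ∧ m < j) * signIf (i < m)) =
      if i = m ∧ j = m then 2 else 0 := by
    unfold signIf
    split_ifs <;> first | omega | norm_num
  rw [hD, hW, hL, hS, hU, hR, hcoef, cutPath_right, cutPath_left, cutPath_up, cutPath_down,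
    hF.flip_rule, hF.flip_rule, fU, fD] at h
  have hP : (1 + flipSign {(i, j)} ({(a, a)} ∆ {(i, j)})) *
      F (cutPath m (i - 1) j ∆ {hEdge (i - 1) j}) ({(a, a)} ∆ {(i, j)}) =
      if i = a ∧ j = a then 2 * F (cutPath m (a - 1) (a - 1)) ∅ else 0 := by
    rw [flipSign_symmDiff, flipSign_singleton, flipSign_singleton,
      signIf_of (Finset.mem_singleton_self (i, j))]
    split_ifs with hij
    · obtain ⟨rfl, rfl⟩ := hij
      rw [signIf_of (Finset.mem_singleton_self _), symmDiff_self, Finset.bot_eq_empty,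
        cutPath_down, hF.flip_rule, flipSign_empty]
      ring
    · rw [signIf_of_not]
      · ring
      · simp only [Finset.mem_singleton, Prod.mk.injEq]
        omega
  have hQ : (if i = m ∧ j = m then (2 : ℝ) else 0) *
      F (cutPath m i j) ({(a, a)} ∆ {(i + 1, j + 1)}) =
      if i = m ∧ j = m then 2 * F ∅ ({(a, a)} ∆ {(m + 1, m + 1)}) else 0 := by
    split_ifs with hij
    · obtain ⟨rfl, rfl⟩ := hij
      rw [cutPath_self]
    · rw [zero_mul]
  rw [hP, hQ] at h
  have s := signIf_mul_self (m < i)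
  unfold cornerObs
  linear_combination h + signIf (j + 1 = a ∧ i < a) *
    F (cutPath m i (j + 1)) ({(a, a)} ∆ {(i, j + 1)}) * s

/-- The part of the fermionic observable that is symmetric under the reflection in the diagonal,
above the diagonal. -/
def symmObs (F : Finset (Site × Site) → Finset Site → ℝ) (a m i j : ℤ) : ℝ :=
  (signIf (m < i) * signIf (j < a) * cornerObs F a m i j + cornerObs F a m j i) / 2

theorem abs_signIf (p : Prop) [Decidable p] : |signIf p| = 1 := by
  unfold signIf
  split_ifs <;> simp

theorem IsCriticalState.abs_symmObs_le (hF : IsCriticalState F) (a m i j : ℤ) :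
    |symmObs F a m i j| ≤ 1 := by
  have h1 := hF.abs_le_one (cutPath m i j) ({(a, a)} ∆ {(i, j)})
  have h2 := hF.abs_le_one (cutPath m j i) ({(a, a)} ∆ {(j, i)})
  have h3 : |signIf (m < i) * signIf (j < a) * cornerObs F a m i j| ≤ 1 := by
    rw [abs_mul, abs_mul, abs_signIf, abs_signIf, one_mul, one_mul]
    exact h1
  rw [symmObs, abs_div, abs_two, div_le_one (by norm_num)]
  refine (abs_add_le _ _).trans ?_
  unfold cornerObs at h3 ⊢
  linarith

/-- Exactly one of the two sign factors is -1 there, so the two halves of the symmetrization cancel.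
-/
theorem symmObs_diag_outside {a m k : ℤ} (ham : a ≤ m) (hk : k < a ∨ m < k) :
    symmObs F a m k k = 0 := by
  have : signIf (m < k) * signIf (k < a) = -1 := by
    unfold signIf
    split_ifs <;> first | omega | norm_num
  rw [symmObs, this]
  ring

theorem symmObs_diag_inside {a m k : ℤ} (hk : a ≤ k) (hkm : k ≤ m) :
    symmObs F a m k k = cornerObs F a m k k := by
  rw [symmObs, signIf_of_not (by omega), signIf_of_not (by omega)]
  ring

/-- Both cuts lie above the diagonal, where the sign factors in `symmObs` absorb them; the reflected
copy comes from below, where there are no cuts, and the source terms live only on the diagonal. -/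
theorem IsCriticalState.symmObs_harmonic (hF : IsCriticalState F) {a m : ℤ} (ham : a ≤ m)
    (i j : ℤ) (hij : i < j) : HarmonicAt (symmObs F a m) i j := by
  have h1 := hF.cornerObs_relation ham i j
  have h2 := hF.cornerObs_relation ham j i
  rw [if_neg (by omega), if_neg (by omega)] at h1 h2
  rw [signIf_of_not (p := j = m ∧ m < i) (by omega),
    signIf_of_not (p := j - 1 = m ∧ m < i) (by omega),
    signIf_of_not (p := i + 1 = a ∧ j < a) (by omega),
    signIf_of_not (p := i = a ∧ j < a) (by omega)] at h2
  have e1 : signIf (m < i) * signIf (i = m ∧ m < j) = signIf (m < i + 1) := by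
    unfold signIf
    split_ifs <;> first | omega | norm_num
  have e2 : signIf (m < i) * signIf (i - 1 = m ∧ m < j) = signIf (m < i - 1) := by
    unfold signIf
    split_ifs <;> first | omega | norm_num
  have e3 : signIf (j < a) * signIf (j + 1 = a ∧ i < a) = signIf (j + 1 < a) := by
    unfold signIf
    split_ifs <;> first | omega | norm_num
  have e4 : signIf (j < a) * signIf (j = a ∧ i < a) = signIf (j - 1 < a) := by
    unfold signIf
    split_ifs <;> first | omega | norm_num
  unfold HarmonicAt symmObs
  rw [← e1, ← e2, ← e3, ← e4]
  linear_combination signIf (m < i) * signIf (j < a) * h1 / 2 + h2 / 2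

theorem IsCriticalState.symmObs_normal (hF : IsCriticalState F) {a m k : ℤ} (hk : a ≤ k)
    (hkm : k ≤ m) :
    symmObs F a m k k - (symmObs F a m (k - 1) k + symmObs F a m k (k + 1)) / 2 =
      ((if k = m then F ∅ ({(a, a)} ∆ {(m + 1, m + 1)}) else 0) +
        if k = a then F (cutPath m (a - 1) (a - 1)) ∅ else 0) / 2 := by
  have h := hF.cornerObs_relation (hk.trans hkm) k k
  rw [signIf_of_not (by omega), signIf_of_not (by omega), signIf_of_not (by omega),
    signIf_of_not (by omega)] at h
  simp only [and_self] at h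
  rw [symmObs_diag_inside hk hkm, symmObs, symmObs, signIf_of_not (by omega),
    signIf_of_not (by omega), signIf_of_not (by omega), signIf_of_not (by omega)]
  split_ifs at h ⊢ <;> linarith

/-- The spin-spin correlation at `n` diagonal steps from `(a, a)`. -/
def spinCorr (F : Finset (Site × Site) → Finset Site → ℝ) (a : ℤ) (n : ℕ) : ℝ :=
  F ∅ ({(a, a)} ∆ {(a + n, a + n)})

/-- The disorder-disorder correlation at `n` diagonal steps from the face `(a, a)`. -/
def disorderCorr (F : Finset (Site × Site) → Finset Site → ℝ) (a : ℤ) (n : ℕ) : ℝ :=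
  F (cutPath (a + n) a a) ∅

/-- Two formulas for the normal derivative of `symmObs` are equated: the Dirichlet-to-Neumann map
and the source terms at the branch points. -/
theorem IsCriticalState.toeplitz_system (hF : IsCriticalState F) (a : ℤ) (n k : ℕ) (hk : k ≤ n) :
    ∑ l ∈ Finset.range (n + 1),
        cornerObs F a (a + n) (a + l) (a + l) / (1 - 4 * ((k : ℝ) - l) ^ 2) =
      Real.pi / 4 * ((if k = n then spinCorr F a (n + 1) else 0) +
        if k = 0 then disorderCorr F (a - 1) (n + 1) else 0) := by
  have ham : a ≤ a + (n : ℤ) := by omega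
  have h1 := normal_derivative_eq (fun i j _ => hF.abs_symmObs_le a (a + n) i j)
    (hF.symmObs_harmonic ham) a n (fun k hk => symmObs_diag_outside ham hk) (a + k)
  rw [hF.symmObs_normal (by omega) (by omega)] at h1
  have e1 : (a + (k : ℤ) = a + n) = (k = n) := by simp
  have e2 : (a + (k : ℤ) = a) = (k = 0) := by simp
  have e3 : spinCorr F a (n + 1) = F ∅ ({(a, a)} ∆ {(a + n + 1, a + n + 1)}) := by
    rw [spinCorr]
    push_cast
    rw [add_assoc]
  have e4 : disorderCorr F (a - 1) (n + 1) = F (cutPath (a + n) (a - 1) (a - 1)) ∅ := by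
    rw [disorderCorr]
    push_cast
    rw [show a - 1 + ((n : ℤ) + 1) = a + n by ring]
  simp only [e1, e2] at h1
  rw [← e3, ← e4] at h1
  have e5 : ∑ l ∈ Finset.range (n + 1),
      symmObs F a (a + n) (a + l) (a + l) / (1 - 4 * (((a + k : ℤ) : ℝ) - a - l) ^ 2) =
      ∑ l ∈ Finset.range (n + 1),
        cornerObs F a (a + n) (a + l) (a + l) / (1 - 4 * ((k : ℝ) - l) ^ 2) := by
    refine Finset.sum_congr rfl fun l hl => ?_
    have := Finset.mem_range.1 hl
    rw [symmObs_diag_inside (by omega) (by omega)]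
    push_cast
    rw [add_sub_cancel_left]
  rw [e5] at h1
  have hpi := Real.pi_ne_zero
  field_simp at h1 ⊢
  linarith

theorem IsCriticalState.corr_zero (hF : IsCriticalState F) (a : ℤ) :
    spinCorr F a 0 = 1 ∧ disorderCorr F a 0 = 1 := by
  simp [spinCorr, disorderCorr, cutPath_self, hF.empty_empty]

theorem IsCriticalState.corr_one_add (hF : IsCriticalState F) (a : ℤ) :
    spinCorr F a 1 + disorderCorr F (a - 1) 1 = 4 / Real.pi := by
  have h := hF.toeplitz_system a 0 0 le_rfl
  have h0 := (hF.corr_zero a).1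
  rw [spinCorr] at h0
  simp only [Nat.cast_zero, add_zero] at h0
  simp only [zero_add, Finset.sum_range_one, Nat.cast_zero, add_zero, cornerObs_diag_right, h0,
    if_true, sub_self] at h
  have hpi := Real.pi_ne_zero
  field_simp
  norm_num at h
  linarith

/-- The end values of the unknown in the Toeplitz system are the disorder (l = 0) and spin (l = n)
correlations at distance n. -/
theorem IsCriticalState.corr_succ (hF : IsCriticalState F) (a : ℤ) {n : ℕ} (hn : 1 ≤ n) :
    spinCorr F a (n + 1) + disorderCorr F (a - 1) (n + 1) =
      2 / Real.pi * Real.Wallis.W n * (spinCorr F a n + disorderCorr F a n) ∧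
    spinCorr F a (n + 1) - disorderCorr F (a - 1) (n + 1) =
      2 / Real.pi * Real.Wallis.W n * ((n + 1) / n) * (spinCorr F a n - disorderCorr F a n) := by
  have h0 : ∀ k, 0 < k → k < n → Real.pi / 4 * ((if k = n then spinCorr F a (n + 1) else 0) +
        if k = 0 then disorderCorr F (a - 1) (n + 1) else 0) = 0 := by
    intro k h1 h2
    rw [if_neg (by omega), if_neg (by omega)]
    ring
  have ha := toeplitz_ends_add hn _ _ (hF.toeplitz_system a n) h0
  have hs := toeplitz_ends_sub hn _ _ (hF.toeplitz_system a n) h0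
  have e1 : cornerObs F a (a + n) (a + (n : ℕ)) (a + (n : ℕ)) = spinCorr F a n :=
    cornerObs_diag_right _ _
  have e2 : cornerObs F a (a + n) (a + (0 : ℕ)) (a + (0 : ℕ)) = disorderCorr F a n := by
    rw [Nat.cast_zero, add_zero]
    exact cornerObs_diag_left _ _
  rw [if_pos rfl, if_neg (by omega), if_neg (by omega), if_pos rfl, e1, e2] at ha hs
  have hpi := Real.pi_ne_zero
  constructor
  · field_simp
    linarith
  · have : spinCorr F a (n + 1) - disorderCorr F (a - 1) (n + 1) = 4 / Real.pi *
      (Real.pi / 4 * (spinCorr F a (n + 1) + 0) -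
        Real.pi / 4 * (0 + disorderCorr F (a - 1) (n + 1))) := by
      field_simp
      ring
    rw [this, hs]
    field_simp
    ring

/-! ### Solution of the recursion and its closed form -/

/-- The diagonal correlations of the critical model. -/
def diagCorr (n : ℕ) : ℝ := (2 / Real.pi) ^ n * ∏ k ∈ Finset.range n, Real.Wallis.W k

theorem diagCorr_succ (n : ℕ) :
    diagCorr (n + 1) = 2 / Real.pi * Real.Wallis.W n * diagCorr n := by
  rw [diagCorr, diagCorr, pow_succ, Finset.prod_range_succ]
  ring

theorem diagCorr_one : diagCorr 1 = 2 / Real.pi := by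
  simp [diagCorr, Real.Wallis.W]

theorem diagCorr_pos (n : ℕ) : 0 < diagCorr n :=
  mul_pos (by have := Real.pi_pos; positivity) (Finset.prod_pos fun k _ => Real.Wallis.W_pos k)

/-- The Wallis lower bound makes (n+1) · `diagCorr (n+1)` grow by a factor of at least 1 +
1/(2(n+1)) per step, so it dominates a harmonic series. -/
theorem mul_diagCorr_ge (n : ℕ) :
    2 / Real.pi * (1 + 1 / 2 * ∑ k ∈ Finset.range n, 1 / ((k : ℝ) + 1)) ≤
      (n + 1) * diagCorr (n + 1) := by
  have hpi := Real.pi_pos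
  have hmono : ∀ n : ℕ, (n + 1) * diagCorr (n + 1) * (1 + 1 / 2 * (1 / ((n : ℝ) + 1))) ≤
      (n + 2) * diagCorr (n + 2) := by
    intro n
    rw [diagCorr_succ (n + 1)]
    have hW := Real.Wallis.le_W (n + 1)
    have hD := diagCorr_pos (n + 1)
    push_cast at hW
    have h2 : (2 * ((n : ℝ) + 1) + 1) / (2 * (n + 1) + 2) ≤ 2 / Real.pi * Real.Wallis.W (n + 1) := by
      calc (2 * ((n : ℝ) + 1) + 1) / (2 * (n + 1) + 2)
          = 2 / Real.pi * ((2 * ((n : ℝ) + 1) + 1) / (2 * (n + 1) + 2) * (Real.pi / 2)) := by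
            field_simp
        _ ≤ _ := by gcongr
    calc (n + 1) * diagCorr (n + 1) * (1 + 1 / 2 * (1 / ((n : ℝ) + 1)))
        = (n + 2) * ((2 * ((n : ℝ) + 1) + 1) / (2 * (n + 1) + 2) * diagCorr (n + 1)) := by
          field_simp
          ring
      _ ≤ _ := by gcongr
  induction n with
  | zero => simp [diagCorr_one]
  | succ n ih =>
    have h := hmono n
    have hge : 2 / Real.pi ≤ (n + 1) * diagCorr (n + 1) := by
      refine le_trans ?_ ih
      have : 0 ≤ ∑ k ∈ Finset.range n, 1 / ((k : ℝ) + 1) := Finset.sum_nonneg fun k _ => by positivity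
      nlinarith [show 0 < 2 / Real.pi by positivity]
    rw [Finset.sum_range_succ]
    push_cast
    rw [show (n : ℝ) + 1 + 1 = n + 2 by ring]
    have h3 : 2 / Real.pi * (1 / 2 * (1 / ((n : ℝ) + 1))) ≤
        (n + 1) * diagCorr (n + 1) * (1 / 2 * (1 / ((n : ℝ) + 1))) := by gcongr
    calc _ = 2 / Real.pi * (1 + 1 / 2 * ∑ k ∈ Finset.range n, 1 / ((k : ℝ) + 1)) +
          2 / Real.pi * (1 / 2 * (1 / ((n : ℝ) + 1))) := by ring
      _ ≤ (n + 1) * diagCorr (n + 1) +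
          (n + 1) * diagCorr (n + 1) * (1 / 2 * (1 / ((n : ℝ) + 1))) := add_le_add ih h3
      _ = (n + 1) * diagCorr (n + 1) * (1 + 1 / 2 * (1 / ((n : ℝ) + 1))) := by ring
      _ ≤ _ := h

theorem tendsto_mul_diagCorr :
    Tendsto (fun n : ℕ => ((n : ℝ) + 1) * diagCorr (n + 1)) atTop atTop := by
  refine tendsto_atTop_mono mul_diagCorr_ge ?_
  have hpi := Real.pi_pos
  refine Tendsto.const_mul_atTop (by positivity) ?_
  refine tendsto_atTop_add_const_left _ _ ?_
  exact Tendsto.const_mul_atTop (by norm_num) Real.tendsto_sum_range_one_div_nat_succ_atTop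

/-- A critical state whose nearest diagonal spin-spin correlations do not depend on the position
along the diagonal has the diagonal correlations `diagCorr`. -/
theorem IsCriticalState.spinCorr_eq (hF : IsCriticalState F) (c : ℝ)
    (hinv : ∀ a, spinCorr F a 1 = c) (a : ℤ) (n : ℕ) : spinCorr F a n = diagCorr n := by
  have hpi := Real.pi_pos
  -- δ is the deviation from S₁ = D₁; the factor (n+1)/n in the recursion makes its relative effect
  -- grow linearly.
  obtain ⟨δ, hδ⟩ : ∃ δ, c = 2 / Real.pi * (1 + δ) := ⟨c * Real.pi / 2 - 1, by field_simp; ring⟩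
  have key : ∀ n : ℕ, ∀ a, spinCorr F a (n + 1) = diagCorr (n + 1) * (1 + (n + 1) * δ) ∧
      disorderCorr F a (n + 1) = diagCorr (n + 1) * (1 - (n + 1) * δ) := by
    intro n
    induction n with
    | zero =>
      intro a
      have h := hF.corr_one_add (a + 1)
      rw [add_sub_cancel_right, hinv, hδ] at h
      rw [zero_add, hinv, hδ, diagCorr_one]
      refine ⟨by simp, ?_⟩
      have : 4 / Real.pi = 2 * (2 / Real.pi) := by ring
      rw [this] at h
      push_cast
      linear_combination h
    | succ n ih =>
      have hstep : ∀ a, spinCorr F a (n + 1 + 1) = diagCorr (n + 1 + 1) * (1 + (n + 1 + 1) * δ) ∧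
          disorderCorr F (a - 1) (n + 1 + 1) = diagCorr (n + 1 + 1) * (1 - (n + 1 + 1) * δ) := by
        intro a
        obtain ⟨h1, h2⟩ := hF.corr_succ a (n := n + 1) (by omega)
        obtain ⟨i1, i2⟩ := ih a
        rw [i1, i2] at h1 h2
        push_cast at h1 h2
        rw [diagCorr_succ (n + 1)]
        have e1 : 2 / Real.pi * Real.Wallis.W (n + 1) * (diagCorr (n + 1) * (1 + (n + 1) * δ) +
            diagCorr (n + 1) * (1 - (n + 1) * δ)) =
            2 * (2 / Real.pi * Real.Wallis.W (n + 1) * diagCorr (n + 1)) := by ring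
        have e2 : 2 / Real.pi * Real.Wallis.W (n + 1) * (((n : ℝ) + 1 + 1) / (n + 1)) *
            (diagCorr (n + 1) * (1 + (n + 1) * δ) - diagCorr (n + 1) * (1 - (n + 1) * δ)) =
            2 * (n + 1 + 1) * δ * (2 / Real.pi * Real.Wallis.W (n + 1) * diagCorr (n + 1)) := by
          field_simp
          ring
        rw [e1] at h1
        rw [e2] at h2
        constructor
        · linear_combination h1 / 2 + h2 / 2
        · linear_combination h1 / 2 - h2 / 2
      intro a
      refine ⟨by exact_mod_cast (hstep a).1, ?_⟩
      have := (hstep (a + 1)).2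
      rw [add_sub_cancel_right] at this
      exact_mod_cast this
  -- A nonzero δ would make S - D at distance N + 1, namely 2(N+1)δ · `diagCorr (N + 1)`, exceed 2
  -- in absolute value.
  have hδ0 : δ = 0 := by
    by_contra hne
    have habs : 0 < |δ| := abs_pos.2 hne
    obtain ⟨N, hN⟩ := (tendsto_mul_diagCorr.eventually_gt_atTop (1 / |δ|)).exists
    obtain ⟨h1, h2⟩ := key N 0
    have b1 := hF.abs_le_one ∅ ({((0 : ℤ), (0 : ℤ))} ∆ {(0 + ((N + 1 : ℕ) : ℤ), 0 + ((N + 1 : ℕ) : ℤ))})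
    have b2 := hF.abs_le_one (cutPath (0 + ((N + 1 : ℕ) : ℤ)) 0 0) ∅
    have h3 : |2 * (diagCorr (N + 1) * ((N + 1) * δ))| ≤ 2 := by
      have e : 2 * (diagCorr (N + 1) * ((N + 1) * δ)) =
          spinCorr F 0 (N + 1) - disorderCorr F 0 (N + 1) := by rw [h1, h2]; ring
      rw [e]
      refine (abs_sub _ _).trans ?_
      unfold spinCorr disorderCorr
      linarith
    rw [div_lt_iff₀ habs] at hN
    have e : |2 * (diagCorr (N + 1) * ((N + 1) * δ))| = 2 * (((N : ℝ) + 1) * diagCorr (N + 1) * |δ|) := by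
      rw [show 2 * (diagCorr (N + 1) * (((N : ℝ) + 1) * δ)) =
        2 * (((N : ℝ) + 1) * diagCorr (N + 1)) * δ by ring, abs_mul, abs_of_pos
        (by have := diagCorr_pos (N + 1); positivity)]
      ring
    rw [e] at h3
    linarith
  cases n with
  | zero => simp [(hF.corr_zero a).1, diagCorr]
  | succ n => rw [(key n a).1, hδ0]; ring

theorem W_mul_prod (k : ℕ) :
    Real.Wallis.W k * ∏ l ∈ Finset.Ico 1 (k + 1), (1 - 1 / (4 * (l : ℝ) ^ 2)) = 1 := by
  induction k with
  | zero => simp [Real.Wallis.W]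
  | succ k ih =>
    rw [Real.Wallis.W_succ, Finset.prod_Ico_succ_top (by omega)]
    refine Eq.trans ?_ ih
    push_cast
    field_simp
    ring

/-- The factor with index l enters the inverse of `W k` for each k with l ≤ k < n, hence n - l
times. -/
theorem diagCorr_eq (n : ℕ) : diagCorr n = (2 / Real.pi) ^ n *
    ∏ k ∈ Finset.Ico 1 n, (1 - 1 / (4 * (k : ℝ) ^ 2)) ^ ((k : ℤ) - (n : ℤ)) := by
  rw [diagCorr]
  congr 1
  induction n with
  | zero => simp
  | succ n ih =>
    rcases Nat.eq_zero_or_pos n with rfl | hn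
    · simp [Real.Wallis.W]
    have hne : ∀ k ∈ Finset.Ico 1 n, (1 - 1 / (4 * (k : ℝ) ^ 2)) ≠ 0 := by
      intro k hk h
      have hk1 : (1 : ℝ) ≤ k := by exact_mod_cast (Finset.mem_Ico.1 hk).1
      field_simp at h
      nlinarith
    have hW := W_mul_prod n
    rw [Finset.prod_Ico_succ_top (by omega)] at hW
    rw [Finset.prod_range_succ, ih, Finset.prod_Ico_succ_top (by omega), eq_comm]
    have e : ∏ k ∈ Finset.Ico 1 n, (1 - 1 / (4 * (k : ℝ) ^ 2)) ^ ((k : ℤ) - ((n + 1 : ℕ) : ℤ)) =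
        (∏ k ∈ Finset.Ico 1 n, (1 - 1 / (4 * (k : ℝ) ^ 2)) ^ ((k : ℤ) - (n : ℤ))) /
          ∏ k ∈ Finset.Ico 1 n, (1 - 1 / (4 * (k : ℝ) ^ 2)) := by
      rw [← Finset.prod_div_distrib]
      refine Finset.prod_congr rfl fun k hk => ?_
      push_cast
      rw [← sub_sub, zpow_sub_one₀ (hne k hk), ← div_eq_mul_inv]
    rw [e, show (n : ℤ) - ((n + 1 : ℕ) : ℤ) = -1 by push_cast; ring, zpow_neg_one]
    have h1 : ∏ k ∈ Finset.Ico 1 n, (1 - 1 / (4 * (k : ℝ) ^ 2)) ≠ 0 := Finset.prod_ne_zero_iff.2 hne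
    have h2 : (1 - 1 / (4 * (n : ℝ) ^ 2)) ≠ 0 := by
      intro h
      rw [h, mul_zero, mul_zero] at hW
      exact zero_ne_one hW
    rw [div_mul_eq_mul_div, div_eq_iff h1]
    have h3 : (1 - 1 / (4 * (n : ℝ) ^ 2))⁻¹ =
        Real.Wallis.W n * ∏ k ∈ Finset.Ico 1 n, (1 - 1 / (4 * (k : ℝ) ^ 2)) :=
      inv_eq_of_mul_eq_one_left (by linarith)
    rw [h3]
    ring

end

end Ising

/-! ### Finite volume: spin products and Griffiths inequalities -/

namespace Ising

noncomputable section

theorem spin_mul (s t : ℤˣ) : spin (s * t) = spin s * spin t := by simp [spin]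

theorem spin_one : spin 1 = 1 := by simp [spin]

theorem spin_neg (s : ℤˣ) : spin (-s) = -spin s := by simp [spin]

theorem spin_eq (s : ℤˣ) : spin s = 1 ∨ spin s = -1 := by
  rcases Int.units_eq_one_or s with rfl | rfl <;> simp [spin]

theorem spin_mul_self (s : ℤˣ) : spin s * spin s = 1 := by
  rcases spin_eq s with h | h <;> rw [h] <;> norm_num

theorem abs_spin (s : ℤˣ) : |spin s| = 1 := by
  rcases spin_eq s with h | h <;> rw [h] <;> norm_num

/-- The product of the spins in `A`. -/
def spinProd (A : Finset Site) (τ : Site → ℤˣ) : ℝ := ∏ x ∈ A, spin (τ x)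

theorem spinProd_empty (τ : Site → ℤˣ) : spinProd ∅ τ = 1 := Finset.prod_empty

theorem spinProd_singleton (x : Site) (τ : Site → ℤˣ) : spinProd {x} τ = spin (τ x) :=
  Finset.prod_singleton _ _

theorem spinProd_mul (A : Finset Site) (τ ρ : Site → ℤˣ) :
    spinProd A (τ * ρ) = spinProd A τ * spinProd A ρ := by
  simp only [spinProd, Pi.mul_apply, spin_mul, Finset.prod_mul_distrib]

theorem spinProd_symmDiff (A B : Finset Site) (τ : Site → ℤˣ) :
    spinProd (A ∆ B) τ = spinProd A τ * spinProd B τ :=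
  prod_symmDiff_of_mul_self (fun _ => spin_mul_self _) A B

theorem abs_spinProd (A : Finset Site) (τ : Site → ℤˣ) : |spinProd A τ| = 1 := by
  rw [spinProd, Finset.abs_prod]
  exact Finset.prod_eq_one fun x _ => abs_spin _

open scoped Classical in
/-- The spin configurations on the lattice that are equal to `1` outside `Λ`. -/
def configs (Λ : Finset Site) : Finset (Site → ℤˣ) := Finset.univ.image (plusExtend Λ)

theorem mem_configs (Λ : Finset Site) (τ : Site → ℤˣ) : τ ∈ configs Λ ↔ ∀ x ∉ Λ, τ x = 1 := by
  simp only [configs, Finset.mem_image, Finset.mem_univ, true_and]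
  constructor
  · rintro ⟨σ, rfl⟩ x hx
    simp [plusExtend, hx]
  · intro h
    refine ⟨fun x => τ x, funext fun x => ?_⟩
    by_cases hx : x ∈ Λ
    · simp [plusExtend, hx]
    · simp [plusExtend, hx, h x hx]

open scoped Classical in
theorem sum_configs (Λ : Finset Site) (f : (Site → ℤˣ) → ℝ) :
    ∑ τ ∈ configs Λ, f τ = ∑ σ : Λ → ℤˣ, f (plusExtend Λ σ) := by
  refine Finset.sum_image fun σ _ σ' _ h => funext fun x => ?_
  have := congrFun h x
  simpa [plusExtend] using this

/-- The configuration with the spins in `W` flipped. -/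
def flipOn (W : Finset Site) (τ : Site → ℤˣ) : Site → ℤˣ := fun x => if x ∈ W then -τ x else τ x

theorem flipOn_flipOn (W : Finset Site) (τ : Site → ℤˣ) : flipOn W (flipOn W τ) = τ := by
  funext x
  by_cases hx : x ∈ W <;> simp [flipOn, hx]

theorem spin_flipOn (W : Finset Site) (τ : Site → ℤˣ) (x : Site) :
    spin (flipOn W τ x) = signIf (x ∈ W) * spin (τ x) := by
  by_cases hx : x ∈ W <;> simp [flipOn, signIf, hx, spin_neg]

theorem spinProd_flipOn (W A : Finset Site) (τ : Site → ℤˣ) :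
    spinProd A (flipOn W τ) = flipSign W A * spinProd A τ := by
  simp only [spinProd, flipSign, spin_flipOn, Finset.prod_mul_distrib]

theorem sum_configs_flipOn {Λ W : Finset Site} (hW : W ⊆ Λ) (f : (Site → ℤˣ) → ℝ) :
    ∑ τ ∈ configs Λ, f (flipOn W τ) = ∑ τ ∈ configs Λ, f τ := by
  have hmem : ∀ τ ∈ configs Λ, flipOn W τ ∈ configs Λ := by
    intro τ hτ
    rw [mem_configs] at hτ ⊢
    intro x hx
    rw [flipOn, if_neg fun h => hx (hW h), hτ x hx]
  exact Finset.sum_nbij' (flipOn W) (flipOn W) hmem hmem (fun τ _ => flipOn_flipOn W τ)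
    (fun τ _ => flipOn_flipOn W τ) fun _ _ => rfl

theorem sum_configs_mul {Λ : Finset Site} {ρ : Site → ℤˣ} (hρ : ρ ∈ configs Λ)
    (f : (Site → ℤˣ) → ℝ) : ∑ τ ∈ configs Λ, f (ρ * τ) = ∑ τ ∈ configs Λ, f τ := by
  rw [mem_configs] at hρ
  refine Finset.sum_nbij' (fun τ => ρ * τ) (fun τ => ρ⁻¹ * τ) ?_ ?_ ?_ ?_ fun _ _ => rfl
  · intro τ hτ
    rw [mem_configs] at hτ ⊢
    intro x hx
    simp [hτ x hx, hρ x hx]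
  · intro τ hτ
    rw [mem_configs] at hτ ⊢
    intro x hx
    simp [hτ x hx, hρ x hx]
  · intro τ _
    simp
  · intro τ _
    simp

/-- The energy of a configuration with couplings `K` on the edges in `S`. -/
def energy (S : Finset (Site × Site)) (K : Site × Site → ℝ) (τ : Site → ℤˣ) : ℝ :=
  ∑ e ∈ S, K e * (spin (τ e.1) * spin (τ e.2))

/-- The unnormalized correlation of the spins in `A`. -/
def corrSum (Λ : Finset Site) (S : Finset (Site × Site)) (K : Site × Site → ℝ)
    (A : Finset Site) : ℝ :=
  ∑ τ ∈ configs Λ, spinProd A τ * Real.exp (energy S K τ)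

theorem exp_mul_of_sign {s : ℝ} (hs : s = 1 ∨ s = -1) (k : ℝ) :
    Real.exp (k * s) = Real.cosh k + Real.sinh k * s := by
  rcases hs with rfl | rfl
  · rw [mul_one, mul_one, Real.cosh_add_sinh]
  · rw [mul_neg_one, mul_neg_one, ← sub_eq_add_neg, Real.cosh_sub_sinh]

theorem spin_mul_spin_eq (s t : ℤˣ) : spin s * spin t = 1 ∨ spin s * spin t = -1 := by
  rw [← spin_mul]
  exact spin_eq _

/-- High-temperature expansion of one edge, which allows induction on the edge set. -/
theorem corrSum_insert (Λ : Finset Site) {S : Finset (Site × Site)} (K : Site × Site → ℝ)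
    (A : Finset Site) {e : Site × Site} (he : e ∉ S) :
    corrSum Λ (insert e S) K A = Real.cosh (K e) * corrSum Λ S K A +
      Real.sinh (K e) * corrSum Λ S K (A ∆ {e.1} ∆ {e.2}) := by
  simp only [corrSum, Finset.mul_sum]
  rw [← Finset.sum_add_distrib]
  refine Finset.sum_congr rfl fun τ _ => ?_
  rw [energy, Finset.sum_insert he, Real.exp_add, exp_mul_of_sign (spin_mul_spin_eq _ _),
    spinProd_symmDiff, spinProd_symmDiff, spinProd_singleton, spinProd_singleton, energy]
  ring

theorem sum_spinProd_nonneg (Λ A : Finset Site) : 0 ≤ ∑ τ ∈ configs Λ, spinProd A τ := by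
  by_cases h : ∃ x ∈ A, x ∈ Λ
  · obtain ⟨x, hA, hx⟩ := h
    have h1 := sum_configs_flipOn (Finset.singleton_subset_iff.2 hx) (spinProd A)
    have h2 : flipSign {x} A = -1 := by
      rw [flipSign, Finset.prod_eq_single x]
      · exact signIf_of (Finset.mem_singleton_self x)
      · intro y _ hy
        exact signIf_of_not (by simpa using hy)
      · exact fun h => absurd hA h
    simp only [spinProd_flipOn, h2] at h1
    rw [← Finset.mul_sum] at h1
    linarith
  · push Not at h
    refine Finset.sum_nonneg fun τ hτ => ?_
    rw [mem_configs] at hτ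
    rw [spinProd, Finset.prod_eq_one]
    · exact zero_le_one
    · intro x hx
      rw [hτ x (h x hx), spin_one]

/-- Comparison of the correlations with couplings `K` and `|K|`. -/
theorem abs_corrSum_le (Λ : Finset Site) (S : Finset (Site × Site)) (K : Site × Site → ℝ)
    (A : Finset Site) : |corrSum Λ S K A| ≤ corrSum Λ S (fun e => |K e|) A := by
  induction S using Finset.induction_on generalizing A with
  | empty =>
    have h := sum_spinProd_nonneg Λ A
    simp only [corrSum, energy, Finset.sum_empty, Real.exp_zero, mul_one]
    rw [abs_of_nonneg h]
  | insert e S he ih =>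
    rw [corrSum_insert Λ K A he, corrSum_insert Λ _ A he, Real.cosh_abs]
    have h1 := ih A
    have h2 := ih (A ∆ {e.1} ∆ {e.2})
    have h3 := Real.cosh_pos (K e)
    refine (abs_add_le _ _).trans ?_
    rw [abs_mul, abs_mul, abs_of_pos h3, Real.abs_sinh]
    have h4 : 0 ≤ Real.sinh |K e| := Real.sinh_nonneg_iff.2 (abs_nonneg _)
    gcongr

/-- The first Griffiths inequality. -/
theorem corrSum_nonneg (Λ : Finset Site) (S : Finset (Site × Site)) {K : Site × Site → ℝ}
    (hK : ∀ e, 0 ≤ K e) (A : Finset Site) : 0 ≤ corrSum Λ S K A := by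
  have h := abs_corrSum_le Λ S K A
  simp only [abs_of_nonneg (hK _)] at h
  exact (abs_nonneg _).trans h

theorem corrSum_empty_pos (Λ : Finset Site) (S : Finset (Site × Site)) (K : Site × Site → ℝ) :
    0 < corrSum Λ S K ∅ := by
  refine Finset.sum_pos (fun τ _ => ?_) ⟨1, by rw [mem_configs]; intro x _; rfl⟩
  rw [spinProd_empty, one_mul]
  exact Real.exp_pos _

theorem corrSum_le_empty (Λ : Finset Site) (S : Finset (Site × Site)) (K : Site × Site → ℝ)
    (A : Finset Site) : corrSum Λ S K A ≤ corrSum Λ S K ∅ := by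
  refine Finset.sum_le_sum fun τ _ => ?_
  rw [spinProd_empty]
  have := le_of_abs_le (abs_spinProd A τ).le
  gcongr

/-- The second Griffiths inequality. -/
theorem corrSum_mul_le (Λ : Finset Site) (S : Finset (Site × Site)) {K : Site × Site → ℝ}
    (hK : ∀ e, 0 ≤ K e) (A B : Finset Site) :
    corrSum Λ S K A * corrSum Λ S K B ≤ corrSum Λ S K (A ∆ B) * corrSum Λ S K ∅ := by
  -- Duplicated variables: replacing the second configuration ρ by τρ turns the two energies into a
  -- single one with couplings K(1 + ρρ') ≥ 0, to which the first inequality applies.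
  have hsum : corrSum Λ S K (A ∆ B) * corrSum Λ S K ∅ - corrSum Λ S K A * corrSum Λ S K B =
      ∑ ρ ∈ configs Λ, (1 - spinProd B ρ) *
        corrSum Λ S (fun e => K e * (1 + spin (ρ e.1) * spin (ρ e.2))) (A ∆ B) := by
    have e1 : corrSum Λ S K (A ∆ B) * corrSum Λ S K ∅ - corrSum Λ S K A * corrSum Λ S K B =
        ∑ τ ∈ configs Λ, ∑ ρ ∈ configs Λ, spinProd A τ * (spinProd B τ - spinProd B ρ) *
          (Real.exp (energy S K τ) * Real.exp (energy S K ρ)) := by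
      simp only [corrSum]
      rw [Finset.sum_mul_sum, Finset.sum_mul_sum, ← Finset.sum_sub_distrib]
      refine Finset.sum_congr rfl fun τ _ => ?_
      rw [← Finset.sum_sub_distrib]
      refine Finset.sum_congr rfl fun ρ _ => ?_
      rw [spinProd_symmDiff, spinProd_empty]
      ring
    have e2 : ∀ τ ∈ configs Λ, ∑ ρ ∈ configs Λ, spinProd A τ * (spinProd B τ - spinProd B ρ) *
          (Real.exp (energy S K τ) * Real.exp (energy S K ρ)) =
        ∑ ρ ∈ configs Λ, (1 - spinProd B ρ) * (spinProd (A ∆ B) τ *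
          Real.exp (energy S (fun e => K e * (1 + spin (ρ e.1) * spin (ρ e.2))) τ)) := by
      intro τ hτ
      rw [← sum_configs_mul hτ]
      refine Finset.sum_congr rfl fun ρ _ => ?_
      rw [spinProd_mul, spinProd_symmDiff, ← Real.exp_add]
      have : energy S K τ + energy S K (τ * ρ) =
          energy S (fun e => K e * (1 + spin (ρ e.1) * spin (ρ e.2))) τ := by
        simp only [energy]
        rw [← Finset.sum_add_distrib]
        refine Finset.sum_congr rfl fun e _ => ?_
        simp only [Pi.mul_apply, spin_mul]
        ring
      rw [this]
      ring
    rw [e1, Finset.sum_congr rfl e2, Finset.sum_comm]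
    refine Finset.sum_congr rfl fun ρ _ => ?_
    rw [corrSum, Finset.mul_sum]
  have hnonneg : 0 ≤ ∑ ρ ∈ configs Λ, (1 - spinProd B ρ) *
        corrSum Λ S (fun e => K e * (1 + spin (ρ e.1) * spin (ρ e.2))) (A ∆ B) := by
    refine Finset.sum_nonneg fun ρ _ => mul_nonneg ?_ (corrSum_nonneg Λ S (fun e => ?_) _)
    · have := le_of_abs_le (abs_spinProd B ρ).le
      linarith
    · refine mul_nonneg (hK e) ?_
      rcases spin_mul_spin_eq (ρ e.1) (ρ e.2) with h | h <;> rw [h] <;> norm_num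
  linarith

/-! ### Disorder insertions, monotonicity and translations -/

/-- The correlation of the spins in `A`, in the model in `Λ` with `+` boundary conditions, coupling
constant `K` and disorder lines crossing the edges in `E`. -/
def mixedCorr (K : ℝ) (Λ : Finset Site) (E : Finset (Site × Site)) (A : Finset Site) : ℝ :=
  corrSum Λ (edges Λ) (fun e => K * signIf (e ∈ E)) A / corrSum Λ (edges Λ) (fun _ => K) ∅

theorem abs_mixedCorr_le {K : ℝ} (hK : 0 ≤ K) (Λ : Finset Site) (E : Finset (Site × Site))
    (A : Finset Site) : |mixedCorr K Λ E A| ≤ 1 := by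
  have hpos := corrSum_empty_pos Λ (edges Λ) fun _ => K
  rw [mixedCorr, abs_div, abs_of_pos hpos, div_le_one hpos]
  refine (abs_corrSum_le _ _ _ _).trans ?_
  simp only [abs_mul, abs_signIf, mul_one, abs_of_nonneg hK]
  exact corrSum_le_empty _ _ _ _

theorem mixedCorr_empty_empty (K : ℝ) (Λ : Finset Site) : mixedCorr K Λ ∅ ∅ = 1 := by
  have hpos := corrSum_empty_pos Λ (edges Λ) fun _ => K
  simp only [mixedCorr, signIf, Finset.notMem_empty, if_false, mul_one]
  exact div_self hpos.ne'

theorem signIf_mem_symmDiff {α : Type*} [DecidableEq α] (E E' : Finset α) (e : α) :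
    signIf (e ∈ E ∆ E') = signIf (e ∈ E) * signIf (e ∈ E') := by
  by_cases h : e ∈ E <;> by_cases h' : e ∈ E' <;> simp [signIf, Finset.mem_symmDiff, h, h']

/-- Gauge invariance: the substitution flipping the spins in W reverses exactly the couplings on the
edges leaving W. -/
theorem mixedCorr_flip (K : ℝ) {Λ W : Finset Site} (hW : W ⊆ Λ) (E : Finset (Site × Site))
    (A : Finset Site) :
    mixedCorr K Λ (E ∆ edgeBoundary W) A = flipSign W A * mixedCorr K Λ E A := by
  rw [mixedCorr, mixedCorr, ← mul_div_assoc]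
  congr 1
  rw [corrSum, corrSum, ← sum_configs_flipOn hW, Finset.mul_sum]
  refine Finset.sum_congr rfl fun τ _ => ?_
  rw [spinProd_flipOn, mul_assoc]
  congr 3
  refine Finset.sum_congr rfl fun e he => ?_
  have hsign : signIf (e ∈ edgeBoundary W) = signIf (e.1 ∈ W) * signIf (e.2 ∈ W) := by
    obtain ⟨u, w⟩ := e
    have he' := ((mem_edges Λ u w).1 he).1
    have hmem : (u, w) ∈ edgeBoundary W ↔ ((u ∈ W ∨ w ∈ W) ∧ ¬(u ∈ W ∧ w ∈ W)) := by
      rw [edgeBoundary, Finset.mem_filter, mem_edges]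
      tauto
    rw [signIf_congr hmem]
    by_cases h1 : u ∈ W <;> by_cases h2 : w ∈ W <;> simp [signIf, h1, h2]
  beta_reduce
  rw [signIf_mem_symmDiff, hsign, spin_flipOn, spin_flipOn]
  have s1 := signIf_mul_self (e.1 ∈ W)
  have s2 := signIf_mul_self (e.2 ∈ W)
  linear_combination K * signIf (e ∈ E) * spin (τ e.1) * spin (τ e.2) *
    (signIf (e.2 ∈ W) * signIf (e.2 ∈ W) * s1 + s2)

/-- With s the signed product of the end spins, reversing the coupling multiplies the weight by
exp(-2Ks) = cosh 2K - s sinh 2K. This is where criticality enters. -/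
theorem mixedCorr_edge {K : ℝ} (hc : Real.cosh (2 * K) = √2) (hs : Real.sinh (2 * K) = 1)
    {Λ : Finset Site} {e : Site × Site} (he : e ∈ edges Λ) (E : Finset (Site × Site))
    (A : Finset Site) :
    mixedCorr K Λ (E ∆ {e}) A =
      √2 * mixedCorr K Λ E A - signIf (e ∈ E) * mixedCorr K Λ E (A ∆ {e.1} ∆ {e.2}) := by
  simp only [mixedCorr]
  rw [← mul_div_assoc, ← mul_div_assoc, ← sub_div]
  congr 1
  rw [corrSum, corrSum, corrSum, Finset.mul_sum, Finset.mul_sum, ← Finset.sum_sub_distrib]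
  refine Finset.sum_congr rfl fun τ _ => ?_
  have hen : energy (edges Λ) (fun e' => K * signIf (e' ∈ E ∆ {e})) τ =
      energy (edges Λ) (fun e' => K * signIf (e' ∈ E)) τ +
        (-(2 * K)) * (signIf (e ∈ E) * (spin (τ e.1) * spin (τ e.2))) := by
    simp only [energy]
    rw [← Finset.add_sum_erase _ _ he, ← Finset.add_sum_erase (edges Λ) _ he,
      signIf_mem_symmDiff, signIf_of (Finset.mem_singleton_self e)]
    have : ∀ e' ∈ (edges Λ).erase e, K * signIf (e' ∈ E ∆ {e}) * (spin (τ e'.1) * spin (τ e'.2)) =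
        K * signIf (e' ∈ E) * (spin (τ e'.1) * spin (τ e'.2)) := by
      intro e' he'
      rw [signIf_mem_symmDiff, signIf_of_not (p := e' ∈ ({e} : Finset (Site × Site))), mul_one]
      rw [Finset.mem_singleton]
      exact (Finset.mem_erase.1 he').1
    rw [Finset.sum_congr rfl this]
    ring
  have hsgn : signIf (e ∈ E) * (spin (τ e.1) * spin (τ e.2)) = 1 ∨
      signIf (e ∈ E) * (spin (τ e.1) * spin (τ e.2)) = -1 := by
    unfold signIf
    rcases spin_mul_spin_eq (τ e.1) (τ e.2) with h | h <;> rw [h] <;> split_ifs <;> norm_num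
  rw [hen, Real.exp_add, exp_mul_of_sign hsgn, Real.cosh_neg, Real.sinh_neg, hc, hs,
    spinProd_symmDiff, spinProd_symmDiff, spinProd_singleton, spinProd_singleton]
  ring

theorem edges_mono {Λ Λ' : Finset Site} (h : Λ ⊆ Λ') : edges Λ ⊆ edges Λ' := by
  rintro ⟨u, w⟩ he
  rw [mem_edges] at he ⊢
  exact ⟨he.1, he.2.imp (@h _) (@h _)⟩

/-- The factor 1 + σ_x is 2 or 0, so it imposes the `+` condition at x; the extra edges then join
two `+` spins and contribute only a constant. -/
theorem corrSum_insert_site {x : Site} {Λ : Finset Site} (hx : x ∉ Λ) (K : ℝ) :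
    ∃ c : ℝ, 0 < c ∧ ∀ A : Finset Site,
      corrSum (insert x Λ) (edges (insert x Λ)) (fun _ => K) A +
        corrSum (insert x Λ) (edges (insert x Λ)) (fun _ => K) (A ∆ {x}) =
      c * corrSum Λ (edges Λ) (fun _ => K) A := by
  refine ⟨2 * Real.exp (∑ _e ∈ edges (insert x Λ) \ edges Λ, K), by positivity, fun A => ?_⟩
  have hsub : configs Λ ⊆ configs (insert x Λ) := by
    intro τ hτ
    rw [mem_configs] at hτ ⊢
    exact fun y hy => hτ y fun h => hy (Finset.mem_insert_of_mem h)
  rw [corrSum, corrSum, ← Finset.sum_add_distrib, ← Finset.sum_subset hsub, corrSum,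
    Finset.mul_sum]
  · refine Finset.sum_congr rfl fun τ hτ => ?_
    rw [mem_configs] at hτ
    have hen : energy (edges (insert x Λ)) (fun _ => K) τ =
        (∑ _e ∈ edges (insert x Λ) \ edges Λ, K) + energy (edges Λ) (fun _ => K) τ := by
      rw [energy, ← Finset.sum_sdiff (edges_mono (Finset.subset_insert x Λ)), energy]
      congr 1
      refine Finset.sum_congr rfl fun e he => ?_
      obtain ⟨u, w⟩ := e
      rw [Finset.mem_sdiff, mem_edges, mem_edges] at he
      rw [hτ u (by tauto), hτ w (by tauto), spin_one, mul_one, mul_one]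
    rw [hen, Real.exp_add, spinProd_symmDiff, spinProd_singleton, hτ x hx, spin_one]
    ring
  · intro τ hτ hτ'
    rw [mem_configs] at hτ hτ'
    have hτx : τ x = -1 := by
      refine (Int.units_eq_one_or _).resolve_left fun h => hτ' fun y hy => ?_
      by_cases hyx : y = x
      · rw [hyx, h]
      · exact hτ y (by simp [hyx, hy])
    rw [spinProd_symmDiff, spinProd_singleton, hτx, spin_neg, spin_one]
    ring

/-- The correlations with `+` boundary conditions decrease with the domain. -/
theorem antitone_mixedCorr {K : ℝ} (hK : 0 ≤ K) (A : Finset Site) :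
    Antitone fun Λ => mixedCorr K Λ ∅ A := by
  rw [Finset.antitone_iff_forall_insert_le]
  intro Λ x hx
  simp only [mixedCorr, signIf, Finset.notMem_empty, if_false, mul_one]
  obtain ⟨c, hc, h⟩ := corrSum_insert_site hx K
  have hA := h A
  have h0 := h ∅
  -- σ_x is nonnegatively correlated with the spins in A, so fixing it to +1 can only raise their
  -- correlation.
  have hgks := corrSum_mul_le (insert x Λ) (edges (insert x Λ)) (K := fun _ => K) (fun _ => hK) A {x}
  have hpos := corrSum_empty_pos Λ (edges Λ) fun _ => K
  have hpos' := corrSum_empty_pos (insert x Λ) (edges (insert x Λ)) fun _ => K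
  have e : (∅ : Finset Site) ∆ {x} = {x} := by
    rw [← Finset.bot_eq_empty, bot_symmDiff]
  rw [e] at h0
  rw [div_le_div_iff₀ hpos' hpos]
  refine le_of_mul_le_mul_left ?_ hc
  calc c * (corrSum (insert x Λ) (edges (insert x Λ)) (fun _ => K) A *
        corrSum Λ (edges Λ) (fun _ => K) ∅)
      = corrSum (insert x Λ) (edges (insert x Λ)) (fun _ => K) A *
        (c * corrSum Λ (edges Λ) (fun _ => K) ∅) := by ring
    _ ≤ (c * corrSum Λ (edges Λ) (fun _ => K) A) *
        corrSum (insert x Λ) (edges (insert x Λ)) (fun _ => K) ∅ := by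
      rw [← hA, ← h0]
      linarith
    _ = _ := by ring

/-- The translate of a finite set of sites. -/
def shift (t : Site) (A : Finset Site) : Finset Site := A.image (· + t)

theorem mem_shift (t x : Site) (A : Finset Site) : x ∈ shift t A ↔ x - t ∈ A := by
  simp only [shift, Finset.mem_image]
  constructor
  · rintro ⟨y, hy, rfl⟩
    rwa [add_sub_cancel_right]
  · exact fun h => ⟨x - t, h, sub_add_cancel x t⟩

theorem edges_shift (t : Site) (Λ : Finset Site) :
    edges (shift t Λ) = (edges Λ).image fun e => (e.1 + t, e.2 + t) := by
  ext ⟨u, w⟩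
  rw [mem_edges, mem_shift, mem_shift, Finset.mem_image]
  constructor
  · rintro ⟨h, h'⟩
    refine ⟨(u - t, w - t), (mem_edges _ _ _).2 ⟨?_, h'⟩, by simp⟩
    rcases h with rfl | rfl
    · left; abel
    · right; abel
  · rintro ⟨⟨u', w'⟩, h, heq⟩
    rw [mem_edges] at h
    rw [Prod.mk.injEq] at heq
    obtain ⟨rfl, rfl⟩ := heq
    rw [add_sub_cancel_right, add_sub_cancel_right]
    refine ⟨?_, h.2⟩
    rcases h.1 with rfl | rfl
    · exact Or.inl (add_right_comm _ _ _)
    · exact Or.inr (add_right_comm _ _ _)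

theorem corrSum_shift (t : Site) (K : ℝ) (Λ A : Finset Site) :
    corrSum (shift t Λ) (edges (shift t Λ)) (fun _ => K) (shift t A) =
      corrSum Λ (edges Λ) (fun _ => K) A := by
  rw [corrSum, corrSum]
  refine Finset.sum_nbij' (fun τ x => τ (x + t)) (fun τ x => τ (x - t)) ?_ ?_ ?_ ?_ ?_
  · intro τ hτ
    rw [mem_configs] at hτ ⊢
    intro x hx
    exact hτ (x + t) (by rwa [mem_shift, add_sub_cancel_right])
  · intro τ hτ
    rw [mem_configs] at hτ ⊢
    intro x hx
    exact hτ (x - t) (by rwa [mem_shift] at hx)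
  · intro τ _
    simp
  · intro τ _
    simp
  · intro τ _
    have h1 : spinProd (shift t A) τ = spinProd A fun x => τ (x + t) :=
      Finset.prod_image fun x _ y _ h => add_right_cancel h
    have h2 : energy (edges (shift t Λ)) (fun _ => K) τ =
        energy (edges Λ) (fun _ => K) fun x => τ (x + t) := by
      rw [energy, edges_shift, Finset.sum_image]
      · rfl
      · rintro ⟨u, w⟩ _ ⟨u', w'⟩ _ h
        simpa using h
    rw [h1, h2]

theorem mixedCorr_shift (t : Site) (K : ℝ) (Λ A : Finset Site) :
    mixedCorr K (shift t Λ) ∅ (shift t A) = mixedCorr K Λ ∅ A := by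
  have e : shift t ∅ = ∅ := Finset.image_empty _
  have h := corrSum_shift t K Λ ∅
  rw [e] at h
  simp only [mixedCorr, signIf, Finset.notMem_empty, if_false, mul_one]
  rw [corrSum_shift, h]

theorem tendsto_shift_atTop (t : Site) : Tendsto (shift t) atTop atTop := by
  refine tendsto_atTop_atTop.2 fun B => ⟨shift (-t) B, fun Λ hΛ x hx => ?_⟩
  rw [mem_shift]
  refine hΛ ?_
  rw [mem_shift, sub_neg_eq_add, sub_add_cancel]
  exact hx

end

end Ising

/-! ### Infinite-volume limit -/

namespace Ising

theorem diagonalCorrelation_eq (β J : ℝ) (Λ : Finset Site) (n : ℕ) :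
    diagonalCorrelation β J Λ n =
      mixedCorr (β * J) Λ ∅ ({(0, 0)} ∆ {((n : ℤ), (n : ℤ))}) := by
  have hw : ∀ σ : Λ → ℤˣ, weight β J Λ σ =
      Real.exp (energy (edges Λ) (fun _ => β * J) (plusExtend Λ σ)) := by
    intro σ
    rw [weight, energy, Finset.mul_sum]
    congr 1
    exact Finset.sum_congr rfl fun e _ => by ring
  have hZ : partitionFunction β J Λ = corrSum Λ (edges Λ) (fun _ => β * J) ∅ := by
    rw [partitionFunction, corrSum, sum_configs]
    exact Finset.sum_congr rfl fun σ _ => by rw [hw, spinProd_empty, one_mul]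
  simp only [diagonalCorrelation, expectation, prob, mixedCorr, signIf, Finset.notMem_empty,
    if_false, mul_one]
  rw [hZ]
  generalize corrSum Λ (edges Λ) (fun _ => β * J) ∅ = Z
  rw [corrSum, sum_configs, Finset.sum_div]
  refine Finset.sum_congr rfl fun σ _ => ?_
  rw [hw, spinProd_symmDiff, spinProd_singleton, spinProd_singleton]
  ring

/-- Limits of the correlations in finite domains along ultrafilters are critical states. -/
theorem isCriticalState_of_tendsto {K : ℝ} (hK : 0 ≤ K) (hc : Real.cosh (2 * K) = √2)
    (hs : Real.sinh (2 * K) = 1) {l : Filter (Finset Site)} [l.NeBot] (hl : l ≤ atTop)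
    {F : Finset (Site × Site) → Finset Site → ℝ}
    (hF : ∀ E A, Tendsto (fun Λ => mixedCorr K Λ E A) l (𝓝 (F E A))) : IsCriticalState F := by
  have hedge : ∀ (E : Finset (Site × Site)) (A : Finset Site) (e : Site × Site),
      (e.2 = e.1 + (1, 0) ∨ e.2 = e.1 + (0, 1)) → F (E ∆ {e}) A =
      √2 * F E A - signIf (e ∈ E) * F E (A ∆ {e.1} ∆ {e.2}) := by
    intro E A e he
    refine tendsto_nhds_unique (hF _ _) ?_
    refine (((hF E A).const_mul _).sub ((hF E _).const_mul _)).congr' ?_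
    filter_upwards [hl (eventually_ge_atTop {e.1})] with Λ hΛ
    refine (mixedCorr_edge hc hs ?_ E A).symm
    exact (mem_edges Λ e.1 e.2).2 ⟨he, Or.inl (hΛ (Finset.mem_singleton_self _))⟩
  refine ⟨fun E A => ?_, ?_, fun E A x y => ?_, fun E A x y => ?_, fun E A W => ?_⟩
  · exact le_of_tendsto (hF E A).abs (Eventually.of_forall fun Λ => abs_mixedCorr_le hK Λ E A)
  · refine tendsto_nhds_unique (hF ∅ ∅) ?_
    simp only [mixedCorr_empty_empty]
    exact tendsto_const_nhds
  · exact hedge E A (hEdge x y) (Or.inl (by simp))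
  · exact hedge E A (vEdge x y) (Or.inr (by simp))
  · refine tendsto_nhds_unique (hF _ _) (((hF E A).const_mul _).congr' ?_)
    filter_upwards [hl (eventually_ge_atTop W)] with Λ hΛ
    exact (mixedCorr_flip K hΛ E A).symm

theorem tendsto_mixedCorr {K : ℝ} (hK : 0 ≤ K) (A : Finset Site) :
    Tendsto (fun Λ => mixedCorr K Λ ∅ A) atTop (𝓝 (⨅ Λ, mixedCorr K Λ ∅ A)) := by
  refine tendsto_atTop_ciInf (antitone_mixedCorr hK A) ⟨-1, ?_⟩
  rintro _ ⟨Λ, rfl⟩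
  exact (abs_le.1 (abs_mixedCorr_le hK Λ ∅ A)).1

theorem iInf_mixedCorr_shift {K : ℝ} (hK : 0 ≤ K) (t : Site) (A : Finset Site) :
    ⨅ Λ, mixedCorr K Λ ∅ (shift t A) = ⨅ Λ, mixedCorr K Λ ∅ A := by
  refine tendsto_nhds_unique ((tendsto_mixedCorr hK (shift t A)).comp (tendsto_shift_atTop t)) ?_
  refine (tendsto_mixedCorr hK A).congr fun Λ => ?_
  exact (mixedCorr_shift t K Λ A).symm

/-- The infinite-volume diagonal correlations at the critical point. -/
theorem tendsto_mixedCorr_diagCorr {K : ℝ} (hK : 0 ≤ K) (hc : Real.cosh (2 * K) = √2)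
    (hs : Real.sinh (2 * K) = 1) (n : ℕ) :
    Tendsto (fun Λ => mixedCorr K Λ ∅ ({(0, 0)} ∆ {((n : ℤ), (n : ℤ))})) atTop
      (𝓝 (diagCorr n)) := by
  rw [tendsto_iff_ultrafilter]
  -- Convergence of correlations with disorder lines is not known, but they are bounded, so
  -- compactness gives limits along each ultrafilter.
  intro g hg
  have hlim : ∀ E A, ∃ x, Tendsto (fun Λ => mixedCorr K Λ E A) g (𝓝 x) := by
    intro E A
    obtain ⟨x, -, hx⟩ := (isCompact_Icc (a := (-1 : ℝ)) (b := 1)).ultrafilter_le_nhds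
      (g.map fun Λ => mixedCorr K Λ E A) (by
        rw [le_principal_iff, Ultrafilter.coe_map, mem_map]
        exact Eventually.of_forall fun Λ => abs_le.1 (abs_mixedCorr_le hK Λ E A))
    exact ⟨x, hx⟩
  choose F hF using hlim
  have hcrit := isCriticalState_of_tendsto hK hc hs hg hF
  -- Pure spin correlations converge along all domains, so their limit does not depend on the
  -- ultrafilter and inherits translation invariance.
  have hinv : ∀ a, spinCorr F a 1 = ⨅ Λ, mixedCorr K Λ ∅ ({(0, 0)} ∆ {(1, 1)}) := by
    intro a
    rw [← iInf_mixedCorr_shift hK (a, a)]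
    have e : shift (a, a) ({(0, 0)} ∆ {(1, 1)}) = {(a, a)} ∆ {(a + (1 : ℕ), a + (1 : ℕ))} := by
      rw [shift, Finset.image_symmDiff _ _ (add_left_injective (a, a))]
      simp [add_comm]
    rw [e]
    exact tendsto_nhds_unique (hF _ _) ((tendsto_mixedCorr hK _).mono_left hg)
  have h := hcrit.spinCorr_eq _ hinv 0 n
  rw [← h, spinCorr]
  simpa using hF ∅ ({(0, 0)} ∆ {((n : ℤ), (n : ℤ))})

end Ising

theorem mainTheorem5 (β J : ℝ)
    (hcrit : Real.exp (-2 * β * J) = Real.tan ((1 / 2) * (Real.pi / 4))) (n : ℕ) :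
    Ising.IsInfiniteVolumeDiagonalCorrelation β J n
      ((2 / Real.pi) ^ n *
        ∏ k ∈ Finset.Ico 1 n, (1 - 1 / (4 * (k : ℝ) ^ 2)) ^ ((k : ℤ) - (n : ℤ))) := by
  have h2 : √2 * √2 = 2 := Real.mul_self_sqrt (by norm_num)
  have h1 : 1 < √2 := by
    rw [Real.lt_sqrt] <;> norm_num
  have hcos : Real.cos (Real.pi / 8) ≠ 0 := by
    refine (Real.cos_pos_of_mem_Ioo ⟨?_, ?_⟩).ne' <;> linarith [Real.pi_pos]
  -- This is tan(π/8) = √2 - 1, from the double-angle formulas at π/4.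
  have hexp : Real.exp (-(2 * (β * J))) = √2 - 1 := by
    rw [show -(2 * (β * J)) = -2 * β * J by ring, hcrit,
      show (1 / 2 : ℝ) * (Real.pi / 4) = Real.pi / 8 by ring]
    have hs := Real.sin_two_mul (Real.pi / 8)
    have hc := Real.cos_two_mul (Real.pi / 8)
    rw [show 2 * (Real.pi / 8) = Real.pi / 4 by ring] at hs hc
    rw [Real.sin_pi_div_four] at hs
    rw [Real.cos_pi_div_four] at hc
    rw [Real.tan_eq_sin_div_cos, div_eq_iff hcos]
    apply mul_right_cancel₀ hcos
    linear_combination (-1 / 2) * hs + (√2 - 1) * hc / 2 - h2 / 4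
  have hexp' : Real.exp (2 * (β * J)) = √2 + 1 := by
    rw [← neg_neg (2 * (β * J)), Real.exp_neg, hexp]
    refine inv_eq_of_mul_eq_one_left ?_
    linear_combination h2
  have hK : 0 ≤ β * J := by
    have : 0 < 2 * (β * J) := by
      rw [← Real.exp_lt_exp, Real.exp_zero, hexp']
      linarith
    linarith
  have hc : Real.cosh (2 * (β * J)) = √2 := by
    rw [Real.cosh_eq, hexp, hexp']
    ring
  have hs : Real.sinh (2 * (β * J)) = 1 := by
    rw [Real.sinh_eq, hexp, hexp']
    ring
  rw [← Ising.diagCorr_eq]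
  refine (Ising.tendsto_mixedCorr_diagCorr hK hc hs n).congr fun Λ => ?_
  exact (Ising.diagonalCorrelation_eq β J Λ n).symm
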